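/- Let $\delta_1,\delta_2,\delta_3>0$ with $\delta_1+\delta_2+\delta_3=2\pi$. Consider octahedra $\Sigma\subset\mathbb R^3$ with labelled vertices $v_1,v_2,v_3,v_{1'}=-v_1,v_{2'}=-v_2,v_{3'}=-v_3$ (with $v_1,v_2,v_3$ linearly independent) whose cone-deficit ($2\pi$ minus the sum of the four face angles) at $v_i$ and at $v_{i'}$ is $\delta_i$, for $i=1,2,3$. Let $T_1=v_1v_{2'}v_{3'}$, $T_2=v_1v_2v_{3'}$, $T_3=v_1v_2v_3$, $T_4=v_1v_{2'}v_3$ be the faces at $v_1$, let $\omega_{ij}$ be the angle of $T_i$ at $v_j$, and put $$\alpha=\tfrac12(\omega_{12'}+\omega_{42'}+\omega_{43}+\omega_{33}-\pi),\qquad \beta=\tfrac12(\omega_{32}+\omega_{22}+\omega_{23'}+\omega_{13'}-\pi).$$ (i) For every such $\Sigma$ there is a unique choice of one point in the relative interior of each of the eight faces, written $O_i\in T_i$ and $O_{i'}\in T_{i'}=-T_i$, such that $O_{i'}=-O_i$; for every edge $pq$ of $\Sigma$, with $O,O'$ the chosen points of the two faces adjacent to $pq$, the geodesic quadrilateral $O\,p\,O'\,q$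 is a parallelogram (that is, $|Op|=|O'q|$ and $|Oq|=|O'p|$); and $\angle O_3v_3v_2=\angle O_1v_{2'}v_{3'}=\alpha$, $\angle O_3v_2v_3=\angle O_1v_{3'}v_{2'}=\beta$. These twelve parallelograms form the parallelogram-decomposition of $\Sigma$. Its coordinates are the lengths $$a=|O_1v_{3'}|,\quad b=|O_1v_{2'}|,\quad c=|O_1v_1|,\quad d=|O_3v_1|.$$ (ii) The surface area of $\Sigma$ is $$2\left[(ab+cd)\sin\tfrac{\delta_1}{2}+(ac+bd)\sin\tfrac{\delta_2}{2}+(ad+bc)\sin\tfrac{\delta_3}{2}\right].$$ (iii) Call two such octahedra equivalent if there is an isometry between them (as subsets of $\mathbb R^3$, possibly orientation-reversing) that respects the vertex labels. Then $\Sigma\mapsto(a,b,c,d)$ is well defined on equivalence classes, and it is a homeomorphism from the space of equivalence classes (with the quotient of the topology given by the positions of the vertices) onto the positive orthant $\{(a,b,c,d)\in\mathbb R^4: a,b,c,d>0\}$. -/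

import Mathlib

/-- Euclidean three-space. -/
abbrev E3 : Type := EuclideanSpace ℝ (Fin 3)

/-- A centrally symmetric octahedron with labelled vertices `v₁, v₂, v₃` (here `vertex 0`,
`vertex 1`, `vertex 2`) and `v₁' = -v₁, v₂' = -v₂, v₃' = -v₃`. It is the convex hull of these six
points; it is nondegenerate exactly when `v₁, v₂, v₃` are linearly independent. -/
structure LabeledOctahedron where
  /-- The vertices `v₁, v₂, v₃`. -/
  vertex : Fin 3 → E3
  /-- The octahedron is not flat. -/
  linearIndependent : LinearIndependent ℝ vertex

namespace LabeledOctahedron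

/-- The six vertices: `pt i 1 = vᵢ` and `pt i (-1) = vᵢ' = -vᵢ`. -/
def pt (P : LabeledOctahedron) (i : Fin 3) (s : ℤˣ) : E3 := s • P.vertex i

/-- The solid octahedron. -/
def body (P : LabeledOctahedron) : Set E3 :=
  convexHull ℝ (Set.range fun p : Fin 3 × ℤˣ => P.pt p.1 p.2)

theorem pt_mem_body (P : LabeledOctahedron) (i : Fin 3) (s : ℤˣ) : P.pt i s ∈ P.body :=
  subset_convexHull ℝ _ ⟨(i, s), rfl⟩

/-- The six vertices as points of the octahedron. -/
def bodyPt (P : LabeledOctahedron) (i : Fin 3) (s : ℤˣ) : P.body := ⟨P.pt i s, P.pt_mem_body i s⟩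

/-! The eight triangular faces are indexed by sign vectors `ε`: the face `ε` has the vertices
`pt 0 (ε 0)`, `pt 1 (ε 1)`, `pt 2 (ε 2)`. The antipodal map sends the face `ε` to the face `-ε`. -/

/-- The relative interior of the face `ε`: points with positive barycentric coordinates. -/
def openFace (P : LabeledOctahedron) (ε : Fin 3 → ℤˣ) : Set E3 :=
  {x | ∃ w : Fin 3 → ℝ, (∀ i, 0 < w i) ∧ ∑ i, w i = 1 ∧ x = ∑ i, w i • P.pt i (ε i)}

/-- The angle of the triangle `ε` at its vertex `pt i (ε i)`. -/
noncomputable def faceAngle (P : LabeledOctahedron) (ε : Fin 3 → ℤˣ) (i : Fin 3) : ℝ :=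
  EuclideanGeometry.angle (P.pt (i + 1) (ε (i + 1))) (P.pt i (ε i)) (P.pt (i + 2) (ε (i + 2)))

/-- The area of the triangle `ε`: half the product of two sides and the sine of their angle. -/
noncomputable def faceArea (P : LabeledOctahedron) (ε : Fin 3 → ℤˣ) : ℝ :=
  dist (P.pt 0 (ε 0)) (P.pt 1 (ε 1)) * dist (P.pt 0 (ε 0)) (P.pt 2 (ε 2)) *
    Real.sin (P.faceAngle ε 0) / 2

/-- The surface area: the sum of the areas of the eight faces. -/
noncomputable def surfaceArea (P : LabeledOctahedron) : ℝ :=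
  ∑ ε : Fin 3 → ℤˣ, P.faceArea ε

/-- The cone-angle at the vertex `pt i s`: the sum of the angles there of the four faces that
contain it. -/
noncomputable def coneAngle (P : LabeledOctahedron) (i : Fin 3) (s : ℤˣ) : ℝ :=
  ∑ ε : Fin 3 → ℤˣ with ε i = s, P.faceAngle ε i

/-- The cone-deficit at the vertex `pt i s`. -/
noncomputable def coneDeficit (P : LabeledOctahedron) (i : Fin 3) (s : ℤˣ) : ℝ :=
  2 * Real.pi - P.coneAngle i s

/-- The face `T₁` with vertices `v₁, v₂', v₃'`. -/
def T₁ : Fin 3 → ℤˣ := ![1, -1, -1]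

/-- The face `T₂` with vertices `v₁, v₂, v₃'`. -/
def T₂ : Fin 3 → ℤˣ := ![1, 1, -1]

/-- The face `T₃` with vertices `v₁, v₂, v₃`. -/
def T₃ : Fin 3 → ℤˣ := ![1, 1, 1]

/-- The face `T₄` with vertices `v₁, v₂', v₃`. -/
def T₄ : Fin 3 → ℤˣ := ![1, -1, 1]

/-- The angle `α = (ω₁₂' + ω₄₂' + ω₄₃ + ω₃₃ - π) / 2`, where `ωᵢⱼ` is the angle at `vⱼ` in `Tᵢ`. -/
noncomputable def alpha (P : LabeledOctahedron) : ℝ :=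
  (P.faceAngle T₁ 1 + P.faceAngle T₄ 1 + P.faceAngle T₄ 2 + P.faceAngle T₃ 2 - Real.pi) / 2

/-- The angle `β = (ω₃₂ + ω₂₂ + ω₂₃' + ω₁₃' - π) / 2`. -/
noncomputable def beta (P : LabeledOctahedron) : ℝ :=
  (P.faceAngle T₃ 1 + P.faceAngle T₂ 1 + P.faceAngle T₂ 2 + P.faceAngle T₁ 2 - Real.pi) / 2

/-- `O` gives the eight extra points (one for every face) of the decomposition of the surface into
twelve parallelograms, one parallelogram for every edge. -/
structure IsParallelogramDecomposition (P : LabeledOctahedron) (O : (Fin 3 → ℤˣ) → E3) :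
    Prop where
  /-- Every extra point lies in the interior of its face. -/
  mem_openFace : ∀ ε, O ε ∈ P.openFace ε
  /-- The decomposition is invariant under the antipodal map. -/
  antipodal : ∀ ε, O (-ε) = -O ε
  /-- If the faces `ε ≠ ε'` share the edge with end points `p = pt i (ε i)`, `q = pt j (ε j)`, then
  the geodesic quadrilateral `O ε, p, O ε', q` is a parallelogram: the opposite sides `O ε, p` and
  `O ε', q` have equal lengths (and, interchanging `i` and `j`, so do the other two). -/
  parallelogram : ∀ (ε ε' : Fin 3 → ℤˣ) (i j : Fin 3), ε ≠ ε' → i ≠ j → ε i = ε' i → ε j = ε' j →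
    dist (O ε) (P.pt i (ε i)) = dist (O ε') (P.pt j (ε j))
  /-- `∠ O₃ v₃ v₂ = α`. -/
  angle_O₃_v₃ : EuclideanGeometry.angle (O T₃) (P.pt 2 1) (P.pt 1 1) = P.alpha
  /-- `∠ O₃ v₂ v₃ = β`. -/
  angle_O₃_v₂ : EuclideanGeometry.angle (O T₃) (P.pt 1 1) (P.pt 2 1) = P.beta
  /-- `∠ O₁ v₂' v₃' = α`. -/
  angle_O₁_v₂' : EuclideanGeometry.angle (O T₁) (P.pt 1 (-1)) (P.pt 2 (-1)) = P.alpha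
  /-- `∠ O₁ v₃' v₂' = β`. -/
  angle_O₁_v₃' : EuclideanGeometry.angle (O T₁) (P.pt 2 (-1)) (P.pt 1 (-1)) = P.beta

/-- The coordinates `(a, b, c, d)`: the lengths of `O₁v₃'`, `O₁v₂'`, `O₁v₁`, `O₃v₁`. -/
noncomputable def coords (P : LabeledOctahedron) (O : (Fin 3 → ℤˣ) → E3) : Fin 4 → ℝ :=
  ![dist (O T₁) (P.pt 2 (-1)), dist (O T₁) (P.pt 1 (-1)), dist (O T₁) (P.pt 0 1),
    dist (O T₃) (P.pt 0 1)]

/-- There is an isometry between the two octahedra that respects the labels of the vertices. -/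
def LabelIsometric (P Q : LabeledOctahedron) : Prop :=
  ∃ f : P.body ≃ᵢ Q.body, ∀ i s, f (P.bodyPt i s) = Q.bodyPt i s

end LabeledOctahedron

/-- The labelled centrally symmetric octahedra with cone-deficit `δ i` at both `vᵢ` and `vᵢ'`. -/
def OctahedraWithDeficits (δ : Fin 3 → ℝ) : Type :=
  {P : LabeledOctahedron // ∀ i s, P.coneDeficit i s = δ i}

/-- Octahedra are topologized by the positions of their vertices. -/
instance (δ : Fin 3 → ℝ) : TopologicalSpace (OctahedraWithDeficits δ) :=
  TopologicalSpace.induced (fun P => P.1.vertex) inferInstance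

/-- Two octahedra are equivalent if there is a label-respecting isometry between them. -/
instance octahedraSetoid (δ : Fin 3 → ℝ) : Setoid (OctahedraWithDeficits δ) where
  r P Q := P.1.LabelIsometric Q.1
  iseqv :=
    { refl := fun P => ⟨IsometryEquiv.refl _, fun _ _ => rfl⟩
      symm := fun ⟨f, hf⟩ => ⟨f.symm, fun i s => by rw [← hf i s, f.symm_apply_apply]⟩
      trans := fun ⟨f, hf⟩ ⟨g, hg⟩ => ⟨f.trans g, fun i s => by
        rw [IsometryEquiv.trans_apply, hf, hg]⟩ }

/-- The space of labelled centrally symmetric octahedra with prescribed cone-deficits, up to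
label-respecting isometry, with the quotient topology. -/
abbrev OctahedronSpace (δ : Fin 3 → ℝ) : Type := Quotient (octahedraSetoid δ)

/-!
# Parallelogram decompositions of centrally symmetric octahedra

Suppose that a decomposition is given. The parallelogram condition forces the distances from the
extra points `O₁`, `O₂`, `O₃`, `O₄` to the vertices `v₁`, `±v₂`, `±v₃` of their faces to be
`(c, b, a)`, `(a, d, c)`, `(d, a, b)`, `(b, c, d)` (`FaceSystem`). The two triangles over an edge
are then congruent, and since the angles around each extra point add up to `2π`, linear algebra
shows that every extra point sees the edges `vᵢvⱼ` of its face under the angle `π - δₖ / 2`, and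
that the angles `∠ O₃v₃v₂` and `∠ O₃v₂v₃` are `α` and `β` (`FaceSystem.angles`). By the law of
cosines the six edge lengths are explicit functions of `a, b, c, d` (`EdgeLaw`), which gives the
area and shows that `a, b, c, d` determine the octahedron up to isometry. Conversely, `a, b, c, d`
are explicit continuous functions of the octahedron (`coordFormula`), whence uniqueness.

For existence, `v₁ + v₂`, `v₁ - v₃`, `v₂ - v₃` are linearly independent, and the angles between them
are angles of `T₁`, `T₃` and `T₄`. The strict triangle inequality for this trihedron says exactly
that `α` is positive and less than the angles of `T₁` and `T₃` that it has to fit into; the same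
holds for `β`. This gives `O₁` and `O₃`, with two common distances `a, b`. Reflecting `O₁` and `O₃`
in the midpoints of the edges of `T₂` at `v₁` gives the same point `O₂` because `2β` is the sum of
the angles of `T₁` and `T₃` containing `β` minus the angle of `T₂` at `v₁`; likewise for `O₄`. If
`O₂` or `O₄` were not inside its face, the angles around these points would contradict `0 < δ₁`
(`exists_faceSystem`).

Every `(a, b, c, d)` in the positive orthant occurs: the Gram determinant of `v₁ + v₂`, `v₁ - v₃`,
`v₂ - v₃` that the edge law prescribes is `4abcd sin (δ₁/2) sin (δ₂/2) sin (δ₃/2)` times half of the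
area, hence positive, and a Cholesky decomposition yields vertices that depend continuously on
`(a, b, c, d)` (`vertexOfCoords`). The extra points are recovered in barycentric coordinates
(`exists_inTriangle_dist_eq`), so the cone-deficits are the prescribed ones.
-/

/-! ### Angles in cones and triangles -/

open InnerProductGeometry in
theorem angle_eq_add_of_nonneg_combination {V : Type*} [NormedAddCommGroup V]
    [InnerProductSpace ℝ V] {x y z : V} {s t : ℝ} (hs : 0 ≤ s) (ht : 0 ≤ t) (hy : y ≠ 0)
    (h : y = s • x + t • z) : angle x z = angle x y + angle y z := by
  refine angle_eq_angle_add_add_angle_add_of_mem_span hy ?_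
  rw [Submodule.mem_span_pair]
  exact ⟨⟨s, hs⟩, ⟨t, ht⟩, h.symm⟩

open InnerProductGeometry in
theorem angle_sum_eq_two_pi_of_balanced {V : Type*} [NormedAddCommGroup V]
    [InnerProductSpace ℝ V] {x y z : V} {p q r : ℝ} (hp : 0 < p) (hq : 0 < q) (hr : 0 < r)
    (hz : z ≠ 0) (h : p • x + q • y + r • z = 0) :
    angle x y + angle y z + angle x z = 2 * Real.pi := by
  have hz' : -z = (p / r) • x + (q / r) • y := by
    have : r • (-z) = p • x + q • y := by
      rw [smul_neg, neg_eq_iff_add_eq_zero, add_comm]; exact h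
    rw [← inv_smul_smul₀ hr.ne' (-z), this, smul_add, smul_smul, smul_smul, div_eq_inv_mul,
      div_eq_inv_mul]
  have := angle_eq_add_of_nonneg_combination (by positivity) (by positivity) (neg_ne_zero.2 hz) hz'
  rw [angle_neg_right, angle_neg_left, angle_comm z y] at this
  linarith

/-- The strict triangle inequality for the angles of a nondegenerate trihedron. -/
theorem angle_lt_add_of_linearIndependent {V : Type*} [NormedAddCommGroup V]
    [InnerProductSpace ℝ V] {x y z : V}
    (key : ∀ a b c : ℝ, a • x + b • y + c • z = 0 → a = 0 ∧ b = 0 ∧ c = 0) :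
    InnerProductGeometry.angle x z <
      InnerProductGeometry.angle x y + InnerProductGeometry.angle y z := by
  refine lt_of_le_of_ne (InnerProductGeometry.angle_le_angle_add_angle x y z) fun heq => ?_
  have hy : y ≠ 0 := by
    rintro rfl
    have := key 0 1 0 (by simp)
    simp at this
  rcases (InnerProductGeometry.angle_eq_angle_add_angle_iff hy).1 heq with hpi | hmem
  · obtain ⟨-, r, -, rfl⟩ := InnerProductGeometry.angle_eq_pi_iff.1 hpi
    have := key (-r) 0 1 (by simp)
    simp at this
  · rw [Submodule.mem_span_pair] at hmem
    obtain ⟨s, t, hst⟩ := hmem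
    have := key s (-1) t (by rw [← hst]; simp only [NNReal.smul_def]; module)
    simp at this

/-- The angle between the sides of lengths `x` and `y` in a triangle whose third side has
length `z`. -/
noncomputable def sideAngle (x y z : ℝ) : ℝ := Real.arccos ((x ^ 2 + y ^ 2 - z ^ 2) / (2 * (x * y)))

theorem sideAngle_comm (x y z : ℝ) : sideAngle x y z = sideAngle y x z := by
  rw [sideAngle, sideAngle, add_comm (x ^ 2), mul_comm x]

theorem angle_eq_sideAngle {V : Type*} [NormedAddCommGroup V] [InnerProductSpace ℝ V]
    (p q r : V) : EuclideanGeometry.angle p q r = sideAngle (dist p q) (dist r q) (dist p r) := by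
  have h : (dist p q ^ 2 + dist r q ^ 2 - dist p r ^ 2) / (2 * (dist p q * dist r q)) =
      inner ℝ (p - q) (r - q) / (‖p - q‖ * ‖r - q‖) := by
    have h1 : dist p r = ‖(p - q) - (r - q)‖ := by rw [dist_eq_norm]; congr 1; abel
    have h2 := norm_sub_sq_real (p - q) (r - q)
    rw [h1, h2, dist_eq_norm, dist_eq_norm]
    rw [show ‖p - q‖ ^ 2 + ‖r - q‖ ^ 2 - (‖p - q‖ ^ 2 - 2 * inner ℝ (p - q) (r - q) +
      ‖r - q‖ ^ 2) = 2 * inner ℝ (p - q) (r - q) by ring, mul_div_mul_left _ _ two_ne_zero]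
  rw [sideAngle, h]
  rfl

/-- `O` is a point of the relative interior of the triangle `p q r`. -/
def InTriangle {V : Type*} [AddCommGroup V] [Module ℝ V] (p q r O : V) : Prop :=
  ∃ u v w : ℝ, 0 < u ∧ 0 < v ∧ 0 < w ∧ u + v + w = 1 ∧ O = u • p + v • q + w • r

namespace InTriangle

variable {V : Type*} [NormedAddCommGroup V] [InnerProductSpace ℝ V] {p q r O : V}

theorem rotate (h : InTriangle p q r O) : InTriangle q r p O := by
  obtain ⟨u, v, w, hu, hv, hw, hs, rfl⟩ := h
  exact ⟨v, w, u, hv, hw, hu, by linarith, by abel⟩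

theorem ne_left (h : InTriangle p q r O) (hc : ¬Collinear ℝ {p, q, r}) : O ≠ p := by
  obtain ⟨u, v, w, hu, hv, hw, hs, rfl⟩ := h
  intro heq
  apply hc
  apply collinear_insert_of_mem_affineSpan_pair
  have hvw : v + w ≠ 0 := by positivity
  have h1 : (v + w) • p = v • q + w • r := by
    have : v + w = 1 - u := by linarith
    rw [this, sub_smul, one_smul]
    nth_rewrite 1 [← heq]
    abel
  have h2 : p = AffineMap.lineMap q r (w / (v + w)) := by
    have h4 : v / (v + w) + w / (v + w) = 1 := by field_simp
    have h3 : p = (v / (v + w)) • q + (w / (v + w)) • r := by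
      rw [← inv_smul_smul₀ hvw p, h1, smul_add, smul_smul, smul_smul, div_eq_inv_mul,
        div_eq_inv_mul]
    rw [AffineMap.lineMap_apply_module, ← h4]
    rw [add_sub_cancel_right]
    exact h3
  rw [h2]
  exact AffineMap.lineMap_mem_affineSpan_pair _ _ _

theorem not_collinear_rotate (hc : ¬Collinear ℝ {p, q, r}) : ¬Collinear ℝ {q, r, p} := by
  rwa [Set.insert_comm, Set.pair_comm] at hc

theorem angle_sum (h : InTriangle p q r O) (hc : ¬Collinear ℝ {p, q, r}) :
    EuclideanGeometry.angle p O q + EuclideanGeometry.angle q O r +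
      EuclideanGeometry.angle p O r = 2 * Real.pi := by
  have hr : r ≠ O := (h.rotate.rotate.ne_left
    (not_collinear_rotate (not_collinear_rotate hc))).symm
  obtain ⟨u, v, w, hu, hv, hw, hs, hO⟩ := h
  refine angle_sum_eq_two_pi_of_balanced hu hv hw (sub_ne_zero.2 hr) ?_
  simp only [vsub_eq_sub, smul_sub]
  have : O = u • O + v • O + w • O := by rw [← add_smul, ← add_smul, hs, one_smul]
  rw [show u • p - u • O + (v • q - v • O) + (w • r - w • O) =
    (u • p + v • q + w • r) - (u • O + v • O + w • O) by abel, ← this, ← hO, sub_self]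

theorem angle_left (h : InTriangle p q r O) (hc : ¬Collinear ℝ {p, q, r}) :
    EuclideanGeometry.angle q p r =
      EuclideanGeometry.angle q p O + EuclideanGeometry.angle O p r := by
  have hp : O ≠ p := h.ne_left hc
  obtain ⟨u, v, w, hu, hv, hw, hs, hO⟩ := h
  refine angle_eq_add_of_nonneg_combination hv.le hw.le (sub_ne_zero.2 hp) ?_
  have hu' : u = 1 - v - w := by linarith
  rw [hO, hu']
  simp only [vsub_eq_sub]
  module

end InTriangle

theorem sideAngle_sum {V : Type*} [NormedAddCommGroup V] [InnerProductSpace ℝ V]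
    {p q O : V} (h : p ≠ q) :
    sideAngle (dist O p) (dist O q) (dist p q) + sideAngle (dist O p) (dist p q) (dist O q) +
      sideAngle (dist O q) (dist p q) (dist O p) = Real.pi := by
  have := EuclideanGeometry.angle_add_angle_add_angle_eq_pi O h.symm
  rw [angle_eq_sideAngle, angle_eq_sideAngle, angle_eq_sideAngle] at this
  simp only [dist_comm p O, dist_comm q O, dist_comm q p] at this
  rw [sideAngle_comm (dist p q) (dist O q), sideAngle_comm (dist O q) (dist O p)] at this
  linarith

/-- All the angles around a point in the interior of a triangle, in terms of lengths. -/
theorem InTriangle.sideAngle_relations {V : Type*} [NormedAddCommGroup V] [InnerProductSpace ℝ V]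
    {p q r O : V} (h : InTriangle p q r O) (hc : ¬Collinear ℝ {p, q, r}) {x y z N L M : ℝ}
    (hx : dist O p = x) (hy : dist O q = y) (hz : dist O r = z)
    (hN : dist p q = N) (hL : dist q r = L) (hM : dist p r = M) :
    (sideAngle x y N + sideAngle y z L + sideAngle x z M = 2 * Real.pi) ∧
    EuclideanGeometry.angle q p r = sideAngle x N y + sideAngle x M z ∧
    EuclideanGeometry.angle r q p = sideAngle y N x + sideAngle y L z ∧
    EuclideanGeometry.angle p r q = sideAngle z M x + sideAngle z L y ∧
    sideAngle x y N + sideAngle x N y + sideAngle y N x = Real.pi ∧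
    sideAngle y z L + sideAngle y L z + sideAngle z L y = Real.pi ∧
    sideAngle x z M + sideAngle x M z + sideAngle z M x = Real.pi := by
  subst hx hy hz hN hL hM
  have hc1 := not_collinear_rotate hc
  have hc2 := not_collinear_rotate hc1
  have e0 := h.angle_sum hc
  have e1 := h.angle_left hc
  have e2 := h.rotate.angle_left hc1
  have e3 := h.rotate.rotate.angle_left hc2
  have c1 := angle_eq_sideAngle q p O
  have c2 := angle_eq_sideAngle O p r
  have c3 := angle_eq_sideAngle r q O
  have c4 := angle_eq_sideAngle O q p
  have c5 := angle_eq_sideAngle p r O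
  have c6 := angle_eq_sideAngle O r q
  rw [angle_eq_sideAngle, angle_eq_sideAngle, angle_eq_sideAngle] at e0
  simp only [dist_comm p O, dist_comm q O, dist_comm r O, dist_comm q p, dist_comm r q,
    dist_comm r p] at *
  rw [sideAngle_comm] at c1 c3 c5
  refine ⟨e0, by linarith, by linarith, by linarith, sideAngle_sum (ne₁₂_of_not_collinear hc),
    sideAngle_sum (ne₂₃_of_not_collinear hc), sideAngle_sum (ne₁₃_of_not_collinear hc)⟩

/-! ### Faces, angles and edge lengths -/

namespace LabeledOctahedron

variable (P : LabeledOctahedron)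

theorem pt_neg (i : Fin 3) (s : ℤˣ) : P.pt i (-s) = -P.pt i s := by
  simp [pt, Units.smul_def]

theorem pt_one (i : Fin 3) : P.pt i 1 = P.vertex i := one_smul _ _

theorem dist_pt_neg (i j : Fin 3) (s t : ℤˣ) :
    dist (P.pt i (-s)) (P.pt j (-t)) = dist (P.pt i s) (P.pt j t) := by
  rw [pt_neg, pt_neg, dist_neg_neg]

theorem faceAngle_neg (ε : Fin 3 → ℤˣ) (i : Fin 3) : P.faceAngle (-ε) i = P.faceAngle ε i := by
  simp only [faceAngle, angle_eq_sideAngle, Pi.neg_apply, dist_pt_neg]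

/-- The eight sign vectors are `T₁`, `T₂`, `T₃`, `T₄` and their negatives. -/
theorem sum_signs (f : (Fin 3 → ℤˣ) → ℝ) :
    ∑ ε, f ε = f T₁ + f T₂ + f T₃ + f T₄ + (f (-T₁) + f (-T₂) + f (-T₃) + f (-T₄)) := by
  have : (Finset.univ : Finset (Fin 3 → ℤˣ)) = {T₁, T₂, T₃, T₄, -T₁, -T₂, -T₃, -T₄} := by decide
  rw [this]
  repeat rw [Finset.sum_insert (by decide)]
  rw [Finset.sum_singleton]
  ring

/-- By central symmetry only the four faces at `v₁` matter for the cone-angles. -/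
theorem coneAngle_eq (i : Fin 3) (s : ℤˣ) :
    P.coneAngle i s = P.faceAngle T₁ i + P.faceAngle T₂ i + P.faceAngle T₃ i +
      P.faceAngle T₄ i := by
  rw [coneAngle, Finset.sum_filter, sum_signs]
  simp only [faceAngle_neg]
  rcases Int.units_eq_one_or s with rfl | rfl <;> fin_cases i <;>
    simp [T₁, T₂, T₃, T₄] <;> ring

theorem linearIndependent_pt (ε : Fin 3 → ℤˣ) :
    LinearIndependent ℝ fun i => P.pt i (ε i) := by
  convert P.linearIndependent.units_smul (fun i => Units.map (Int.castRingHom ℝ).toMonoidHom (ε i))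
    using 1
  funext i
  simp [pt, Units.smul_def, Int.cast_smul_eq_zsmul]

theorem not_collinear_pt (r s t : ℤˣ) : ¬Collinear ℝ {P.pt 0 r, P.pt 1 s, P.pt 2 t} := by
  rw [← affineIndependent_iff_not_collinear_set]
  have := (P.linearIndependent_pt ![r, s, t]).affineIndependent
  have heq : (fun i => P.pt i (![r, s, t] i)) = ![P.pt 0 r, P.pt 1 s, P.pt 2 t] := by
    funext i
    fin_cases i <;> rfl
  rwa [heq] at this

theorem mem_openFace_iff (ε : Fin 3 → ℤˣ) (x : E3) :
    x ∈ P.openFace ε ↔ InTriangle (P.pt 0 (ε 0)) (P.pt 1 (ε 1)) (P.pt 2 (ε 2)) x := by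
  constructor
  · rintro ⟨w, hw, hs, rfl⟩
    refine ⟨w 0, w 1, w 2, hw 0, hw 1, hw 2, ?_, ?_⟩
    · rw [← hs, Fin.sum_univ_three]
    · rw [Fin.sum_univ_three]
  · rintro ⟨u, v, w, hu, hv, hw, hs, rfl⟩
    refine ⟨![u, v, w], ?_, ?_, ?_⟩
    · intro i; fin_cases i <;> assumption
    · simpa [Fin.sum_univ_three] using hs
    · simp [Fin.sum_univ_three]

/-- Four points, one in each of the faces at `v₁`, at distances from the vertices of these faces
that match in the way forced by the parallelogram condition. -/
structure FaceSystem (O₁ O₂ O₃ O₄ : E3) (a b c d : ℝ) : Prop where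
  mem₁ : InTriangle (P.pt 0 1) (P.pt 1 (-1)) (P.pt 2 (-1)) O₁
  mem₂ : InTriangle (P.pt 0 1) (P.pt 1 1) (P.pt 2 (-1)) O₂
  mem₃ : InTriangle (P.pt 0 1) (P.pt 1 1) (P.pt 2 1) O₃
  mem₄ : InTriangle (P.pt 0 1) (P.pt 1 (-1)) (P.pt 2 1) O₄
  dist₁₀ : dist O₁ (P.pt 0 1) = c
  dist₁₁ : dist O₁ (P.pt 1 (-1)) = b
  dist₁₂ : dist O₁ (P.pt 2 (-1)) = a
  dist₂₀ : dist O₂ (P.pt 0 1) = a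
  dist₂₁ : dist O₂ (P.pt 1 1) = d
  dist₂₂ : dist O₂ (P.pt 2 (-1)) = c
  dist₃₀ : dist O₃ (P.pt 0 1) = d
  dist₃₁ : dist O₃ (P.pt 1 1) = a
  dist₃₂ : dist O₃ (P.pt 2 1) = b
  dist₄₀ : dist O₄ (P.pt 0 1) = b
  dist₄₁ : dist O₄ (P.pt 1 (-1)) = c
  dist₄₂ : dist O₄ (P.pt 2 1) = d

/-- The squared edge lengths of the octahedron with cone-deficits `δ` and coordinates
`a`, `b`, `c`, `d`, as given by the law of cosines. -/
structure EdgeLaw (δ : Fin 3 → ℝ) (a b c d : ℝ) : Prop where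
  e12 : dist (P.pt 0 1) (P.pt 1 1) ^ 2 = a ^ 2 + d ^ 2 + 2 * a * d * Real.cos (δ 2 / 2)
  e12' : dist (P.pt 0 1) (P.pt 1 (-1)) ^ 2 = b ^ 2 + c ^ 2 + 2 * b * c * Real.cos (δ 2 / 2)
  e13 : dist (P.pt 0 1) (P.pt 2 1) ^ 2 = b ^ 2 + d ^ 2 + 2 * b * d * Real.cos (δ 1 / 2)
  e13' : dist (P.pt 0 1) (P.pt 2 (-1)) ^ 2 = a ^ 2 + c ^ 2 + 2 * a * c * Real.cos (δ 1 / 2)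
  e23 : dist (P.pt 1 1) (P.pt 2 1) ^ 2 = a ^ 2 + b ^ 2 + 2 * a * b * Real.cos (δ 0 / 2)
  e23' : dist (P.pt 1 1) (P.pt 2 (-1)) ^ 2 = c ^ 2 + d ^ 2 + 2 * c * d * Real.cos (δ 0 / 2)

theorem dist_pt_neg_one_neg_one (i j : Fin 3) :
    dist (P.pt i (-1)) (P.pt j (-1)) = dist (P.pt i 1) (P.pt j 1) := P.dist_pt_neg i j 1 1

theorem dist_pt_neg_one_one (i j : Fin 3) :
    dist (P.pt i (-1)) (P.pt j 1) = dist (P.pt i 1) (P.pt j (-1)) := by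
  simpa using P.dist_pt_neg i j 1 (-1)

namespace FaceSystem

variable {P} {O₁ O₂ O₃ O₄ : E3} {a b c d : ℝ}

theorem pos (h : P.FaceSystem O₁ O₂ O₃ O₄ a b c d) : 0 < a ∧ 0 < b ∧ 0 < c ∧ 0 < d := by
  have hc := P.not_collinear_pt 1 (-1) (-1)
  rw [← h.dist₁₂, ← h.dist₁₁, ← h.dist₁₀, ← h.dist₃₀, dist_pos, dist_pos, dist_pos, dist_pos]
  exact ⟨h.mem₁.rotate.rotate.ne_left
    (InTriangle.not_collinear_rotate (InTriangle.not_collinear_rotate hc)),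
    h.mem₁.rotate.ne_left (InTriangle.not_collinear_rotate hc), h.mem₁.ne_left hc,
    h.mem₃.ne_left (P.not_collinear_pt 1 1 1)⟩

/-- The cone-deficits determine the angles under which the edges are seen from the extra points.
The two triangles over an edge are congruent, so both see it under the same angle, and the four
base angles at its ends are two supplements of this angle. Around each extra point the angles add
up to `2π`, so the edges `vᵢvⱼ` and `vᵢvⱼ'` are seen under equal angles. Summing base angles at the
vertices then gives the cone-angles, and also `α` and `β`. -/
theorem angles (h : P.FaceSystem O₁ O₂ O₃ O₄ a b c d) :
    (∀ s, P.coneDeficit 0 s = 2 * (Real.pi - sideAngle a b (dist (P.pt 1 1) (P.pt 2 1))) ∧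
      P.coneDeficit 0 s = 2 * (Real.pi - sideAngle c d (dist (P.pt 1 1) (P.pt 2 (-1))))) ∧
    (∀ s, P.coneDeficit 1 s = 2 * (Real.pi - sideAngle b d (dist (P.pt 0 1) (P.pt 2 1))) ∧
      P.coneDeficit 1 s = 2 * (Real.pi - sideAngle a c (dist (P.pt 0 1) (P.pt 2 (-1))))) ∧
    (∀ s, P.coneDeficit 2 s = 2 * (Real.pi - sideAngle a d (dist (P.pt 0 1) (P.pt 1 1))) ∧
      P.coneDeficit 2 s = 2 * (Real.pi - sideAngle b c (dist (P.pt 0 1) (P.pt 1 (-1))))) ∧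
    P.alpha = sideAngle b (dist (P.pt 1 1) (P.pt 2 1)) a ∧
    P.beta = sideAngle a (dist (P.pt 1 1) (P.pt 2 1)) b := by
  obtain ⟨r1, r2, r3, r4, r5, r6, r7⟩ := h.mem₁.sideAngle_relations (P.not_collinear_pt _ _ _)
    h.dist₁₀ h.dist₁₁ h.dist₁₂ rfl (P.dist_pt_neg_one_neg_one 1 2) rfl
  obtain ⟨s1, s2, s3, s4, s5, s6, s7⟩ := h.mem₂.sideAngle_relations (P.not_collinear_pt _ _ _)
    h.dist₂₀ h.dist₂₁ h.dist₂₂ rfl rfl rfl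
  obtain ⟨t1, t2, t3, t4, t5, t6, t7⟩ := h.mem₃.sideAngle_relations (P.not_collinear_pt _ _ _)
    h.dist₃₀ h.dist₃₁ h.dist₃₂ rfl rfl rfl
  obtain ⟨u1, u2, u3, u4, u5, u6, u7⟩ := h.mem₄.sideAngle_relations (P.not_collinear_pt _ _ _)
    h.dist₄₀ h.dist₄₁ h.dist₄₂ rfl (P.dist_pt_neg_one_one 1 2) rfl
  have f10 : P.faceAngle T₁ 0 = _ := r2
  have f11 : P.faceAngle T₁ 1 = _ := r3
  have f12 : P.faceAngle T₁ 2 = _ := r4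
  have f20 : P.faceAngle T₂ 0 = _ := s2
  have f21 : P.faceAngle T₂ 1 = _ := s3
  have f22 : P.faceAngle T₂ 2 = _ := s4
  have f30 : P.faceAngle T₃ 0 = _ := t2
  have f31 : P.faceAngle T₃ 1 = _ := t3
  have f32 : P.faceAngle T₃ 2 = _ := t4
  have f40 : P.faceAngle T₄ 0 = _ := u2
  have f41 : P.faceAngle T₄ 1 = _ := u3
  have f42 : P.faceAngle T₄ 2 = _ := u4
  simp only [coneDeficit, coneAngle_eq, alpha, beta, f10, f11, f12, f20, f21, f22, f30, f31, f32,
    f40, f41, f42]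
  rw [sideAngle_comm c b, sideAngle_comm b a, sideAngle_comm c a] at r1
  rw [sideAngle_comm d c] at s1
  rw [sideAngle_comm d a, sideAngle_comm d b] at t1
  rw [sideAngle_comm c b] at r5
  rw [sideAngle_comm b a] at r6
  rw [sideAngle_comm c a] at r7
  rw [sideAngle_comm d c] at s6
  rw [sideAngle_comm d a] at t5
  rw [sideAngle_comm d b] at t7
  clear r2 r3 r4 s2 s3 s4 t2 t3 t4 u2 u3 u4 f10 f11 f12 f20 f21 f22 f30 f31 f32 f40 f41 f42
  refine ⟨fun _ => ⟨?_, ?_⟩, fun _ => ⟨?_, ?_⟩, fun _ => ⟨?_, ?_⟩, ?_, ?_⟩ <;> linarith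

theorem edgeLaw (h : P.FaceSystem O₁ O₂ O₃ O₄ a b c d) {δ : Fin 3 → ℝ}
    (hδ : ∀ i s, P.coneDeficit i s = δ i) : P.EdgeLaw δ a b c d := by
  have key : ∀ {O p q : E3} {x y t : ℝ}, dist O p = x → dist O q = y →
      t = 2 * (Real.pi - sideAngle x y (dist p q)) →
      dist p q ^ 2 = x ^ 2 + y ^ 2 + 2 * x * y * Real.cos (t / 2) := by
    intro O p q x y t hx hy ht
    have := EuclideanGeometry.dist_sq_eq_dist_sq_add_dist_sq_sub_two_mul_dist_mul_dist_mul_cos_angle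
      p O q
    rw [angle_eq_sideAngle, dist_comm p O, dist_comm q O, hx, hy] at this
    rw [ht, mul_div_cancel_left₀ _ two_ne_zero, Real.cos_pi_sub]
    linarith
  obtain ⟨h0, h1, h2, -⟩ := h.angles
  simp only [hδ, forall_const] at h0 h1 h2
  refine ⟨key h.dist₂₀ h.dist₂₁ h2.1, key h.dist₄₀ h.dist₄₁ h2.2, key h.dist₄₀ h.dist₄₂ h1.1,
    key h.dist₂₀ h.dist₂₂ h1.2, key h.dist₃₁ h.dist₃₂ h0.1, ?_⟩
  rw [dist_comm]
  refine key h.dist₂₂ h.dist₂₁ ?_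
  rw [dist_comm]
  exact h0.2

end FaceSystem

end LabeledOctahedron

/-! ### Decompositions and their coordinates -/

/-- A point in the plane of a triangle is determined by its distances from the vertices. -/
theorem InTriangle.eq_of_dist_eq {V : Type*} [NormedAddCommGroup V] [InnerProductSpace ℝ V]
    {p q r O O' : V} (h : InTriangle p q r O) (h' : InTriangle p q r O')
    (hp : dist O p = dist O' p) (hq : dist O q = dist O' q) (hr : dist O r = dist O' r) :
    O = O' := by
  obtain ⟨u, v, w, -, -, -, hs, hO⟩ := h
  obtain ⟨u', v', w', -, -, -, hs', hO'⟩ := h'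
  -- `O - O'` is a combination of `q - p` and `r - p`, and orthogonal to both
  have key : ∀ x : V, dist O x = dist O' x →
      ‖O‖ ^ 2 - ‖O'‖ ^ 2 = 2 * inner ℝ (O - O') x := by
    intro x hx
    rw [dist_eq_norm, dist_eq_norm] at hx
    have h1 := norm_sub_sq_real O x
    have h2 := norm_sub_sq_real O' x
    rw [hx] at h1
    rw [inner_sub_left]
    linarith
  have hd : O - O' = (v - v') • (q - p) + (w - w') • (r - p) := by
    rw [hO, hO', show u = 1 - v - w by linarith, show u' = 1 - v' - w' by linarith]
    module
  have h0 : inner ℝ (O - O') (O - O') = 0 := by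
    nth_rewrite 2 [hd]
    rw [inner_add_right, inner_smul_right, inner_smul_right, inner_sub_right, inner_sub_right]
    linear_combination ((v - v') * (key p hp - key q hq) + (w - w') * (key p hp - key r hr)) / 2
  exact sub_eq_zero.1 (inner_self_eq_zero.1 h0)

namespace LabeledOctahedron

/-- An antipodally invariant property holds for all faces if it holds for those at `v₁`. -/
theorem forall_of_neg {p : (Fin 3 → ℤˣ) → Prop} (hneg : ∀ ε, p ε → p (-ε)) (h₁ : p T₁)
    (h₂ : p T₂) (h₃ : p T₃) (h₄ : p T₄) (ε : Fin 3 → ℤˣ) : p ε := by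
  have hε : ε ∈ ({T₁, T₂, T₃, T₄, -T₁, -T₂, -T₃, -T₄} : Finset (Fin 3 → ℤˣ)) := by
    revert ε; decide
  simp only [Finset.mem_insert, Finset.mem_singleton] at hε
  rcases hε with rfl | rfl | rfl | rfl | rfl | rfl | rfl | rfl
  exacts [h₁, h₂, h₃, h₄, hneg _ h₁, hneg _ h₂, hneg _ h₃, hneg _ h₄]

/-- The antipodally symmetric family of points with given values on the faces at `v₁`. -/
def antipodalExtension (O₁ O₂ O₃ O₄ : E3) (ε : Fin 3 → ℤˣ) : E3 :=
  if ε 0 = ε 1 then (if ε 0 = ε 2 then ε 0 • O₃ else ε 0 • O₂)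
  else (if ε 0 = ε 2 then ε 0 • O₄ else ε 0 • O₁)

/-- The pattern of the distances in a `FaceSystem`: the distance from the extra point of the face `ε`
to its vertex with index `i` is `signLength` of the sign vector `ε` with the `i`-th sign changed.
Opposite sign vectors have the same length. -/
def signLength (a b c d : ℝ) (ε : Fin 3 → ℤˣ) : ℝ :=
  if ε 0 = ε 1 then (if ε 0 = ε 2 then c else b) else (if ε 0 = ε 2 then a else d)

theorem antipodalExtension_neg (O₁ O₂ O₃ O₄ : E3) (ε : Fin 3 → ℤˣ) :
    antipodalExtension O₁ O₂ O₃ O₄ (-ε) = -antipodalExtension O₁ O₂ O₃ O₄ ε := by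
  unfold antipodalExtension
  simp only [Pi.neg_apply, neg_inj, Units.smul_def, Units.val_neg, neg_smul]
  split_ifs <;> rfl

theorem signLength_neg (a b c d : ℝ) (ε : Fin 3 → ℤˣ) :
    signLength a b c d (-ε) = signLength a b c d ε := by
  simp only [signLength, Pi.neg_apply, neg_inj]

theorem antipodalExtension_T₁ (O₁ O₂ O₃ O₄ : E3) : antipodalExtension O₁ O₂ O₃ O₄ T₁ = O₁ := by
  simp [antipodalExtension, T₁]

theorem antipodalExtension_T₂ (O₁ O₂ O₃ O₄ : E3) : antipodalExtension O₁ O₂ O₃ O₄ T₂ = O₂ := by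
  simp [antipodalExtension, T₂]

theorem antipodalExtension_T₃ (O₁ O₂ O₃ O₄ : E3) : antipodalExtension O₁ O₂ O₃ O₄ T₃ = O₃ := by
  simp [antipodalExtension, T₃]

theorem antipodalExtension_T₄ (O₁ O₂ O₃ O₄ : E3) : antipodalExtension O₁ O₂ O₃ O₄ T₄ = O₄ := by
  simp [antipodalExtension, T₄]

variable {P : LabeledOctahedron}

namespace FaceSystem

variable {O₁ O₂ O₃ O₄ : E3} {a b c d : ℝ}

theorem dist_antipodalExtension (h : P.FaceSystem O₁ O₂ O₃ O₄ a b c d) (ε : Fin 3 → ℤˣ)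
    (i : Fin 3) : dist (antipodalExtension O₁ O₂ O₃ O₄ ε) (P.pt i (ε i)) =
      signLength a b c d (Function.update ε i (-ε i)) := by
  revert ε
  refine forall_of_neg (fun ε hε => ?_) ?_ ?_ ?_ ?_
  · have : Function.update (-ε) i (-(-ε) i) = -Function.update ε i (-ε i) := by
      funext j
      by_cases hj : j = i
      · subst hj; simp
      · simp [hj]
    rw [this, signLength_neg, ← hε, antipodalExtension_neg, Pi.neg_apply, pt_neg, dist_neg_neg]
  · rw [antipodalExtension_T₁]
    fin_cases i <;> simp [T₁, signLength, h.dist₁₀, h.dist₁₁, h.dist₁₂, Function.update]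
  · rw [antipodalExtension_T₂]
    fin_cases i <;> simp [T₂, signLength, h.dist₂₀, h.dist₂₁, h.dist₂₂, Function.update]
  · rw [antipodalExtension_T₃]
    fin_cases i <;> simp [T₃, signLength, h.dist₃₀, h.dist₃₁, h.dist₃₂, Function.update]
  · rw [antipodalExtension_T₄]
    fin_cases i <;> simp [T₄, signLength, h.dist₄₀, h.dist₄₁, h.dist₄₂, Function.update]

/-- For faces `ε`, `ε'` with a common edge `i j`, changing the sign `i` of `ε` and the sign `j` of `ε'`
leads to opposite sign vectors. Hence `signLength` satisfies the parallelogram condition. -/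
theorem update_eq_neg_update : ∀ (ε ε' : Fin 3 → ℤˣ) (i j : Fin 3), ε ≠ ε' → i ≠ j →
    ε i = ε' i → ε j = ε' j → Function.update ε i (-ε i) = -Function.update ε' j (-ε' j) := by
  decide

theorem isParallelogramDecomposition (h : P.FaceSystem O₁ O₂ O₃ O₄ a b c d) :
    P.IsParallelogramDecomposition (antipodalExtension O₁ O₂ O₃ O₄) where
  mem_openFace := by
    refine forall_of_neg (fun ε hε => ?_) ?_ ?_ ?_ ?_
    · obtain ⟨w, hw, hs, hx⟩ := hε
      refine ⟨w, hw, hs, ?_⟩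
      rw [antipodalExtension_neg, hx]
      simp only [Pi.neg_apply, pt_neg, smul_neg, Finset.sum_neg_distrib]
    · rw [antipodalExtension_T₁, mem_openFace_iff]; exact h.mem₁
    · rw [antipodalExtension_T₂, mem_openFace_iff]; exact h.mem₂
    · rw [antipodalExtension_T₃, mem_openFace_iff]; exact h.mem₃
    · rw [antipodalExtension_T₄, mem_openFace_iff]; exact h.mem₄
  antipodal := antipodalExtension_neg O₁ O₂ O₃ O₄
  parallelogram := by
    intro ε ε' i j hne hij hi hj
    rw [h.dist_antipodalExtension, hj, h.dist_antipodalExtension,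
      update_eq_neg_update ε ε' i j hne hij hi hj, signLength_neg]
  angle_O₃_v₃ := by
    rw [antipodalExtension_T₃, h.angles.2.2.2.1, angle_eq_sideAngle, h.dist₃₁, h.dist₃₂]
  angle_O₃_v₂ := by
    rw [antipodalExtension_T₃, h.angles.2.2.2.2, angle_eq_sideAngle, h.dist₃₁, h.dist₃₂,
      dist_comm (P.pt 2 1)]
  angle_O₁_v₂' := by
    rw [antipodalExtension_T₁, h.angles.2.2.2.1, angle_eq_sideAngle, h.dist₁₁, h.dist₁₂,
      dist_pt_neg_one_neg_one, dist_comm (P.pt 2 1)]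
  angle_O₁_v₃' := by
    rw [antipodalExtension_T₁, h.angles.2.2.2.2, angle_eq_sideAngle, h.dist₁₁, h.dist₁₂,
      dist_pt_neg_one_neg_one]

end FaceSystem

theorem IsParallelogramDecomposition.dist_eq {O : (Fin 3 → ℤˣ) → E3}
    (h : P.IsParallelogramDecomposition O) (ε ε' : Fin 3 → ℤˣ) (i j : Fin 3) (s t : ℤˣ)
    (hε : ε ≠ ε' ∧ i ≠ j ∧ ε i = s ∧ ε' i = s ∧ ε j = t ∧ ε' j = t) :
    dist (O ε) (P.pt i s) = dist (O ε') (P.pt j t) := by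
  obtain ⟨hne, hij, rfl, hi, rfl, hj⟩ := hε
  rw [h.parallelogram ε ε' i j hne hij hi.symm hj.symm]

theorem IsParallelogramDecomposition.faceSystem {O : (Fin 3 → ℤˣ) → E3}
    (h : P.IsParallelogramDecomposition O) :
    P.FaceSystem (O T₁) (O T₂) (O T₃) (O T₄) (dist (O T₁) (P.pt 2 (-1)))
      (dist (O T₁) (P.pt 1 (-1))) (dist (O T₁) (P.pt 0 1)) (dist (O T₃) (P.pt 0 1)) where
  mem₁ := (P.mem_openFace_iff T₁ _).1 (h.mem_openFace T₁)
  mem₂ := (P.mem_openFace_iff T₂ _).1 (h.mem_openFace T₂)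
  mem₃ := (P.mem_openFace_iff T₃ _).1 (h.mem_openFace T₃)
  mem₄ := (P.mem_openFace_iff T₄ _).1 (h.mem_openFace T₄)
  dist₁₀ := rfl
  dist₁₁ := rfl
  dist₁₂ := rfl
  dist₂₀ := h.dist_eq T₂ T₁ 0 2 1 (-1) (by decide)
  dist₂₁ := h.dist_eq T₂ T₃ 1 0 1 1 (by decide)
  dist₂₂ := h.dist_eq T₂ T₁ 2 0 (-1) 1 (by decide)
  dist₃₀ := rfl
  dist₃₁ := (h.dist_eq T₃ T₂ 1 0 1 1 (by decide)).trans
    (h.dist_eq T₂ T₁ 0 2 1 (-1) (by decide))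
  dist₃₂ := (h.dist_eq T₃ T₄ 2 0 1 1 (by decide)).trans
    (h.dist_eq T₄ T₁ 0 1 1 (-1) (by decide))
  dist₄₀ := h.dist_eq T₄ T₁ 0 1 1 (-1) (by decide)
  dist₄₁ := h.dist_eq T₄ T₁ 1 0 (-1) 1 (by decide)
  dist₄₂ := h.dist_eq T₄ T₃ 2 0 1 1 (by decide)

variable (P) in
/-- The coordinates of an octahedron with cone-deficits `δ`, computed from its edge lengths and
face angles: two of them are sides of the triangle `O₃v₂v₃` with base angles `α` and `β`, the
other two follow by the law of cosines. -/
noncomputable def coordFormula (δ : Fin 3 → ℝ) : Fin 4 → ℝ :=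
  let a := dist (P.pt 1 1) (P.pt 2 1) * Real.sin P.alpha / Real.sin (δ 0 / 2)
  let b := dist (P.pt 1 1) (P.pt 2 1) * Real.sin P.beta / Real.sin (δ 0 / 2)
  ![a, b,
    √(b ^ 2 + dist (P.pt 0 1) (P.pt 1 (-1)) ^ 2 - 2 * b * dist (P.pt 0 1) (P.pt 1 (-1)) *
      Real.cos (P.faceAngle T₁ 1 - P.alpha)),
    √(a ^ 2 + dist (P.pt 0 1) (P.pt 1 1) ^ 2 - 2 * a * dist (P.pt 0 1) (P.pt 1 1) *
      Real.cos (P.faceAngle T₃ 1 - P.beta))]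

theorem FaceSystem.coordFormula_eq {O₁ O₂ O₃ O₄ : E3} {a b c d : ℝ}
    (h : P.FaceSystem O₁ O₂ O₃ O₄ a b c d) {δ : Fin 3 → ℝ} (hδ : ∀ i s, P.coneDeficit i s = δ i)
    (h0 : 0 < δ 0) (h0' : δ 0 < 2 * Real.pi) : P.coordFormula δ = ![a, b, c, d] := by
  obtain ⟨ha, hb, hc, hd⟩ := h.pos
  have hsin : Real.sin (δ 0 / 2) ≠ 0 :=
    (Real.sin_pos_of_pos_of_lt_pi (by linarith) (by linarith)).ne'
  have hγ := (h.angles.1 1).1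
  have hγ' : sideAngle a b (dist (P.pt 1 1) (P.pt 2 1)) = Real.pi - δ 0 / 2 := by
    rw [hδ] at hγ
    linarith
  have hα := h.angles.2.2.2.1
  have hβ := h.angles.2.2.2.2
  have lawcos : ∀ p q r : E3, dist p r ^ 2 = dist p q ^ 2 + dist r q ^ 2 -
      2 * dist p q * dist r q * Real.cos (sideAngle (dist p q) (dist r q) (dist p r)) := by
    intro p q r
    rw [← angle_eq_sideAngle]
    have := EuclideanGeometry.dist_sq_eq_dist_sq_add_dist_sq_sub_two_mul_dist_mul_dist_mul_cos_angle
      p q r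
    linarith
  have lawsin : ∀ p q r : E3, Real.sin (sideAngle (dist p q) (dist r q) (dist p r)) * dist q r =
      Real.sin (sideAngle (dist r p) (dist q p) (dist r q)) * dist r p := by
    intro p q r
    rw [← angle_eq_sideAngle, ← angle_eq_sideAngle]
    exact EuclideanGeometry.sin_angle_mul_dist_eq_sin_angle_mul_dist p q r
  have hA : dist (P.pt 1 1) (P.pt 2 1) * Real.sin P.alpha / Real.sin (δ 0 / 2) = a := by
    have := lawsin O₃ (P.pt 2 1) (P.pt 1 1)
    rw [dist_comm (P.pt 1 1) O₃, dist_comm (P.pt 2 1) O₃, dist_comm (P.pt 2 1) (P.pt 1 1), h.dist₃₁,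
      h.dist₃₂, ← hα, hγ', Real.sin_pi_sub] at this
    rw [div_eq_iff hsin]
    linarith
  have hB : dist (P.pt 1 1) (P.pt 2 1) * Real.sin P.beta / Real.sin (δ 0 / 2) = b := by
    have := lawsin O₃ (P.pt 1 1) (P.pt 2 1)
    rw [dist_comm (P.pt 1 1) O₃, dist_comm (P.pt 2 1) O₃, dist_comm (P.pt 2 1) (P.pt 1 1), h.dist₃₁,
      h.dist₃₂, ← hβ, sideAngle_comm b, hγ', Real.sin_pi_sub] at this
    rw [div_eq_iff hsin]
    linarith
  obtain ⟨-, -, r3, -, -, -, -⟩ := h.mem₁.sideAngle_relations (P.not_collinear_pt _ _ _)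
    h.dist₁₀ h.dist₁₁ h.dist₁₂ rfl (P.dist_pt_neg_one_neg_one 1 2) rfl
  obtain ⟨-, -, t3, -, -, -, -⟩ := h.mem₃.sideAngle_relations (P.not_collinear_pt _ _ _)
    h.dist₃₀ h.dist₃₁ h.dist₃₂ rfl rfl rfl
  have f11 : P.faceAngle T₁ 1 = _ := r3
  have f31 : P.faceAngle T₃ 1 = _ := t3
  have l1 := lawcos O₁ (P.pt 1 (-1)) (P.pt 0 1)
  have l3 := lawcos O₃ (P.pt 1 1) (P.pt 0 1)
  rw [h.dist₁₀, h.dist₁₁] at l1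
  rw [h.dist₃₀, h.dist₃₁] at l3
  rw [coordFormula]
  simp only [hA, hB]
  rw [f11, f31, hα, hβ, add_sub_cancel_right, add_sub_cancel_right, ← l1, ← l3,
    Real.sqrt_sq hc.le, Real.sqrt_sq hd.le]

end LabeledOctahedron

/-! ### Barycentric coordinates and areas -/

/-- The point with barycentric weights `sin A / x`, `sin B / y`, `sin C / z` has distance `x` from
the first vertex. Behind this is the relation `sin A • e₁ + sin B • e₂ + sin C • e₃ = 0` between unit
vectors at mutual angles `π - A`, `π - B`, `π - C`. -/
theorem dist_barycenter {V : Type*} [NormedAddCommGroup V] [InnerProductSpace ℝ V] {p q r O : V}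
    {x y z A B C k m n D : ℝ} (hx : 0 < x) (hD : 0 < D) (hABC : A + B + C = Real.pi)
    (hN : dist p q ^ 2 = x ^ 2 + y ^ 2 + 2 * x * y * Real.cos C)
    (hM : dist p r ^ 2 = x ^ 2 + z ^ 2 + 2 * x * z * Real.cos B)
    (hL : dist q r ^ 2 = y ^ 2 + z ^ 2 + 2 * y * z * Real.cos A)
    (hk : k * x = Real.sin A) (hm : m * y = Real.sin B) (hn : n * z = Real.sin C)
    (hsum : k + m + n = D) (hO : D • O = k • p + m • q + n • r) : dist O p = x := by
  have h1 : D • (O - p) = m • (q - p) + n • (r - p) := by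
    rw [smul_sub, hO, ← hsum]
    module
  have hA : A = Real.pi - (B + C) := by linarith
  have hcA : Real.cos A = m * y * (n * z) - Real.cos B * Real.cos C := by
    rw [hA, Real.cos_pi_sub, Real.cos_add, hm, hn]; ring
  have hsA : k * x = m * y * Real.cos C + Real.cos B * (n * z) := by
    rw [hk, hA, Real.sin_pi_sub, Real.sin_add, hm, hn]
  have hB := Real.sin_sq_add_cos_sq B
  have hC := Real.sin_sq_add_cos_sq C
  rw [← hm] at hB
  rw [← hn] at hC
  have hsq : (D * dist O p) ^ 2 = (D * x) ^ 2 := by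
    have h2 : (D * dist O p) ^ 2 = m ^ 2 * dist p q ^ 2 + n ^ 2 * dist p r ^ 2 +
        m * n * (dist p q ^ 2 + dist p r ^ 2 - dist q r ^ 2) := by
      have h3 : D * dist O p = ‖D • (O - p)‖ := by
        rw [norm_smul, Real.norm_of_nonneg hD.le, dist_eq_norm]
      have h4 : dist q r = ‖(q - p) - (r - p)‖ := by rw [dist_eq_norm]; congr 1; abel
      rw [h3, h1, norm_add_sq_real, h4, norm_sub_sq_real, dist_comm p q, dist_comm p r,
        dist_eq_norm, dist_eq_norm, norm_smul, norm_smul, mul_pow, mul_pow, Real.norm_eq_abs,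
        Real.norm_eq_abs, sq_abs, sq_abs, inner_smul_left, inner_smul_right]
      simp only [conj_trivial]
      ring
    rw [h2, hN, hM, hL, hcA, ← hsum, show (k + m + n) * x = k * x + (m + n) * x by ring, hsA]
    linear_combination -(n * z) ^ 2 * hB - (m * y) ^ 2 * hC
  have := (sq_eq_sq₀ (by positivity) (by positivity)).1 hsq
  exact mul_left_cancel₀ hD.ne' this

/-- In a triangle whose sides have the lengths that the law of cosines gives for three segments of
lengths `x`, `y`, `z` at mutual angles `π - A`, `π - B`, `π - C`, there is an inner point at
distances `x`, `y`, `z` from the vertices. Its barycentric coordinates are proportional to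
`sin A / x`, `sin B / y`, `sin C / z`. -/
theorem exists_inTriangle_dist_eq {V : Type*} [NormedAddCommGroup V] [InnerProductSpace ℝ V]
    {p q r : V} {x y z A B C : ℝ} (hx : 0 < x) (hy : 0 < y) (hz : 0 < z)
    (hA : 0 < A) (hB : 0 < B) (hC : 0 < C) (hABC : A + B + C = Real.pi)
    (hN : dist p q ^ 2 = x ^ 2 + y ^ 2 + 2 * x * y * Real.cos C)
    (hM : dist p r ^ 2 = x ^ 2 + z ^ 2 + 2 * x * z * Real.cos B)
    (hL : dist q r ^ 2 = y ^ 2 + z ^ 2 + 2 * y * z * Real.cos A) :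
    ∃ O, InTriangle p q r O ∧ dist O p = x ∧ dist O q = y ∧ dist O r = z := by
  have sA : 0 < Real.sin A := Real.sin_pos_of_pos_of_lt_pi hA (by linarith)
  have sB : 0 < Real.sin B := Real.sin_pos_of_pos_of_lt_pi hB (by linarith)
  have sC : 0 < Real.sin C := Real.sin_pos_of_pos_of_lt_pi hC (by linarith)
  obtain ⟨k, hk⟩ : ∃ k, k = Real.sin A / x := ⟨_, rfl⟩
  obtain ⟨m, hm⟩ : ∃ m, m = Real.sin B / y := ⟨_, rfl⟩
  obtain ⟨n, hn⟩ : ∃ n, n = Real.sin C / z := ⟨_, rfl⟩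
  have k0 : 0 < k := hk ▸ div_pos sA hx
  have m0 : 0 < m := hm ▸ div_pos sB hy
  have n0 : 0 < n := hn ▸ div_pos sC hz
  rw [eq_div_iff hx.ne'] at hk
  rw [eq_div_iff hy.ne'] at hm
  rw [eq_div_iff hz.ne'] at hn
  have D0 : 0 < k + m + n := by positivity
  obtain ⟨O, hO⟩ : ∃ O, O = (k / (k + m + n)) • p + (m / (k + m + n)) • q +
    (n / (k + m + n)) • r := ⟨_, rfl⟩
  have hDO : (k + m + n) • O = k • p + m • q + n • r := by
    rw [hO]
    simp only [smul_add, smul_smul, mul_div_cancel₀ _ D0.ne']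
  refine ⟨O, ⟨_, _, _, by positivity, by positivity, by positivity, by field_simp, hO⟩, ?_, ?_, ?_⟩
  · exact dist_barycenter hx D0 hABC hN hM hL hk hm hn rfl hDO
  · refine dist_barycenter (A := B) (B := C) (C := A) (k := m) (m := n) (n := k) (q := r) (r := p)
      (y := z) (z := x) hy D0 (by linarith) hL ?_ ?_ hm hn hk (by ring) (by rw [hDO]; abel)
    · rw [dist_comm, hN]; ring
    · rw [dist_comm, hM]; ring
  · refine dist_barycenter (A := C) (B := A) (C := B) (k := n) (m := k) (n := m) (q := p) (r := q)
      (y := x) (z := y) hz D0 (by linarith) ?_ ?_ hN hn hk hm (by ring) (by rw [hDO]; abel)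
    · rw [dist_comm, hM]; ring
    · rw [dist_comm, hL]; ring

/-- With `N = |pq|²`, `M = |pr|²`, `L = |qr|²`, the term subtracted on the left is the square of the
inner product of `q - p` and `r - p`, so the base on the right is twice the area of the triangle. -/
theorem lengths_mul_sub_inner_sq {x y z A B C N M L : ℝ} (hABC : A + B + C = Real.pi)
    (hN : N = x ^ 2 + y ^ 2 + 2 * x * y * Real.cos C)
    (hM : M = x ^ 2 + z ^ 2 + 2 * x * z * Real.cos B)
    (hL : L = y ^ 2 + z ^ 2 + 2 * y * z * Real.cos A) :
    N * M - ((N + M - L) / 2) ^ 2 =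
      (x * y * Real.sin C + y * z * Real.sin A + x * z * Real.sin B) ^ 2 := by
  have hA : A = Real.pi - (B + C) := by linarith
  have hcA : Real.cos A = Real.sin B * Real.sin C - Real.cos B * Real.cos C := by
    rw [hA, Real.cos_pi_sub, Real.cos_add]; ring
  have hsA : Real.sin A = Real.sin B * Real.cos C + Real.cos B * Real.sin C := by
    rw [hA, Real.sin_pi_sub, Real.sin_add]
  have hB := Real.sin_sq_add_cos_sq B
  have hC := Real.sin_sq_add_cos_sq C
  subst hN hM hL
  rw [hcA, hsA]
  have hB' : Real.sin B ^ 2 = 1 - Real.cos B ^ 2 := by linarith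
  have hC' : Real.sin C ^ 2 = 1 - Real.cos C ^ 2 := by linarith
  ring_nf
  simp only [hB', hC']
  ring

/-- Twice the area of a triangle is the sum over the three triangles with apex at an inner point
that sees the sides under the angles `π - A`, `π - B`, `π - C`. -/
theorem dist_mul_dist_mul_sin_angle {V : Type*} [NormedAddCommGroup V] [InnerProductSpace ℝ V]
    {p q r : V} {x y z A B C : ℝ} (hx : 0 < x) (hy : 0 < y) (hz : 0 < z)
    (hA : 0 < A) (hB : 0 < B) (hC : 0 < C) (hABC : A + B + C = Real.pi)
    (hN : dist p q ^ 2 = x ^ 2 + y ^ 2 + 2 * x * y * Real.cos C)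
    (hM : dist p r ^ 2 = x ^ 2 + z ^ 2 + 2 * x * z * Real.cos B)
    (hL : dist q r ^ 2 = y ^ 2 + z ^ 2 + 2 * y * z * Real.cos A) :
    dist p q * dist p r * Real.sin (EuclideanGeometry.angle q p r) =
      x * y * Real.sin C + y * z * Real.sin A + x * z * Real.sin B := by
  have sA : 0 < Real.sin A := Real.sin_pos_of_pos_of_lt_pi hA (by linarith)
  have sB : 0 < Real.sin B := Real.sin_pos_of_pos_of_lt_pi hB (by linarith)
  have sC : 0 < Real.sin C := Real.sin_pos_of_pos_of_lt_pi hC (by linarith)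
  have h1 := lengths_mul_sub_inner_sq hABC hN hM hL
  have h2 := EuclideanGeometry.dist_sq_eq_dist_sq_add_dist_sq_sub_two_mul_dist_mul_dist_mul_cos_angle
    q p r
  rw [dist_comm q p, dist_comm r p] at h2
  have h3 := Real.sin_sq_add_cos_sq (EuclideanGeometry.angle q p r)
  have h4 : (dist p q ^ 2 + dist p r ^ 2 - dist q r ^ 2) / 2 =
    dist p q * dist p r * Real.cos (EuclideanGeometry.angle q p r) := by linarith
  rw [h4] at h1
  refine (sq_eq_sq₀ ?_ (by positivity)).1 ?_
  · exact mul_nonneg (by positivity) (InnerProductGeometry.sin_angle_nonneg _ _)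
  · rw [← h1]
    linear_combination dist p q ^ 2 * dist p r ^ 2 * h3

namespace LabeledOctahedron

variable {P : LabeledOctahedron} {δ : Fin 3 → ℝ} {a b c d : ℝ}

theorem EdgeLaw.exists_faceSystem (h : P.EdgeLaw δ a b c d) (hpos : ∀ i, 0 < δ i)
    (hsum : ∑ i, δ i = 2 * Real.pi) (ha : 0 < a) (hb : 0 < b) (hc : 0 < c) (hd : 0 < d) :
    ∃ O₁ O₂ O₃ O₄, P.FaceSystem O₁ O₂ O₃ O₄ a b c d := by
  rw [Fin.sum_univ_three] at hsum
  have hs : δ 0 / 2 + δ 1 / 2 + δ 2 / 2 = Real.pi := by linarith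
  have h0 := half_pos (hpos 0)
  have h1 := half_pos (hpos 1)
  have h2 := half_pos (hpos 2)
  obtain ⟨O₁, m1, x1, y1, z1⟩ := exists_inTriangle_dist_eq (p := P.pt 0 1) (q := P.pt 1 (-1))
    (r := P.pt 2 (-1)) hc hb ha h0 h1 h2 hs (by rw [h.e12']; ring) (by rw [h.e13']; ring)
    (by rw [dist_pt_neg_one_neg_one, h.e23]; ring)
  obtain ⟨O₂, m2, x2, y2, z2⟩ := exists_inTriangle_dist_eq (p := P.pt 0 1) (q := P.pt 1 1)
    (r := P.pt 2 (-1)) ha hd hc h0 h1 h2 hs (by rw [h.e12]) (by rw [h.e13'])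
    (by rw [h.e23']; ring)
  obtain ⟨O₃, m3, x3, y3, z3⟩ := exists_inTriangle_dist_eq (p := P.pt 0 1) (q := P.pt 1 1)
    (r := P.pt 2 1) hd ha hb h0 h1 h2 hs (by rw [h.e12]; ring) (by rw [h.e13]; ring)
    (by rw [h.e23])
  obtain ⟨O₄, m4, x4, y4, z4⟩ := exists_inTriangle_dist_eq (p := P.pt 0 1) (q := P.pt 1 (-1))
    (r := P.pt 2 1) hb hc hd h0 h1 h2 hs (by rw [h.e12']) (by rw [h.e13])
    (by rw [dist_pt_neg_one_one, h.e23'])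
  exact ⟨O₁, O₂, O₃, O₄, m1, m2, m3, m4, x1, y1, z1, x2, y2, z2, x3, y3, z3, x4, y4, z4⟩

theorem faceArea_neg (ε : Fin 3 → ℤˣ) : P.faceArea (-ε) = P.faceArea ε := by
  simp only [faceArea, faceAngle_neg, Pi.neg_apply, dist_pt_neg]

theorem EdgeLaw.surfaceArea_eq (h : P.EdgeLaw δ a b c d) (hpos : ∀ i, 0 < δ i)
    (hsum : ∑ i, δ i = 2 * Real.pi) (ha : 0 < a) (hb : 0 < b) (hc : 0 < c) (hd : 0 < d) :
    P.surfaceArea =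
      2 * ((a * b + c * d) * Real.sin (δ 0 / 2) + (a * c + b * d) * Real.sin (δ 1 / 2) +
        (a * d + b * c) * Real.sin (δ 2 / 2)) := by
  rw [Fin.sum_univ_three] at hsum
  have hs : δ 0 / 2 + δ 1 / 2 + δ 2 / 2 = Real.pi := by linarith
  have h0 := half_pos (hpos 0)
  have h1 := half_pos (hpos 1)
  have h2 := half_pos (hpos 2)
  have a1 := dist_mul_dist_mul_sin_angle (p := P.pt 0 1) (q := P.pt 1 (-1))
    (r := P.pt 2 (-1)) hc hb ha h0 h1 h2 hs (by rw [h.e12']; ring) (by rw [h.e13']; ring)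
    (by rw [dist_pt_neg_one_neg_one, h.e23]; ring)
  have a2 := dist_mul_dist_mul_sin_angle (p := P.pt 0 1) (q := P.pt 1 1)
    (r := P.pt 2 (-1)) ha hd hc h0 h1 h2 hs (by rw [h.e12]) (by rw [h.e13'])
    (by rw [h.e23']; ring)
  have a3 := dist_mul_dist_mul_sin_angle (p := P.pt 0 1) (q := P.pt 1 1)
    (r := P.pt 2 1) hd ha hb h0 h1 h2 hs (by rw [h.e12]; ring) (by rw [h.e13]; ring)
    (by rw [h.e23])
  have a4 := dist_mul_dist_mul_sin_angle (p := P.pt 0 1) (q := P.pt 1 (-1))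
    (r := P.pt 2 1) hb hc hd h0 h1 h2 hs (by rw [h.e12']) (by rw [h.e13])
    (by rw [dist_pt_neg_one_one, h.e23'])
  have b1 : 2 * P.faceArea T₁ = _ := (mul_div_cancel₀ _ two_ne_zero).trans a1
  have b2 : 2 * P.faceArea T₂ = _ := (mul_div_cancel₀ _ two_ne_zero).trans a2
  have b3 : 2 * P.faceArea T₃ = _ := (mul_div_cancel₀ _ two_ne_zero).trans a3
  have b4 : 2 * P.faceArea T₄ = _ := (mul_div_cancel₀ _ two_ne_zero).trans a4
  rw [surfaceArea, sum_signs]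
  simp only [faceArea_neg]
  linear_combination b1 + b2 + b3 + b4

/-- The parameters `δ` of the edge law are the cone-deficits: the edge law provides a face system,
and its extra points see the edges under the angles `π - δ i / 2`. -/
theorem EdgeLaw.coneDeficit_eq (h : P.EdgeLaw δ a b c d) (hpos : ∀ i, 0 < δ i)
    (hsum : ∑ i, δ i = 2 * Real.pi) (ha : 0 < a) (hb : 0 < b) (hc : 0 < c) (hd : 0 < d) (i : Fin 3)
    (s : ℤˣ) : P.coneDeficit i s = δ i := by
  obtain ⟨O₁, O₂, O₃, O₄, hF⟩ := h.exists_faceSystem hpos hsum ha hb hc hd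
  rw [Fin.sum_univ_three] at hsum
  have h0 := hpos 0
  have h1 := hpos 1
  have h2 := hpos 2
  have key : ∀ {x y z t : ℝ}, 0 < x → 0 < y → 0 < t → t < 2 * Real.pi →
      z ^ 2 = x ^ 2 + y ^ 2 + 2 * x * y * Real.cos (t / 2) →
      2 * (Real.pi - sideAngle x y z) = t := by
    intro x y z t hx hy ht ht' hz
    have h1 : (x ^ 2 + y ^ 2 - z ^ 2) / (2 * (x * y)) = Real.cos (Real.pi - t / 2) := by
      rw [hz, Real.cos_pi_sub]
      field_simp
      ring
    rw [sideAngle, h1, Real.arccos_cos (by linarith) (by linarith)]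
    ring
  obtain ⟨d0, d1, d2, -⟩ := hF.angles
  have h0' : δ 0 < 2 * Real.pi := by linarith
  have h1' : δ 1 < 2 * Real.pi := by linarith
  have h2' : δ 2 < 2 * Real.pi := by linarith
  fin_cases i
  · exact (d0 s).1.trans (key ha hb h0 h0' h.e23)
  · exact (d1 s).1.trans (key hb hd h1 h1' h.e13)
  · exact (d2 s).1.trans (key ha hd h2 h2' h.e12)

end LabeledOctahedron

/-! ### Points with prescribed angles -/

/-- A unit vector inside the angle between `x` and `y`, at angle `t` from `x`. -/
theorem exists_unit_ray {V : Type*} [NormedAddCommGroup V] [InnerProductSpace ℝ V] {x y : V}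
    {t : ℝ} (hx : x ≠ 0) (hy : y ≠ 0) (hω : InnerProductGeometry.angle x y < Real.pi) (ht : 0 < t)
    (ht' : t < InnerProductGeometry.angle x y) :
    ∃ u v : ℝ, 0 < u ∧ 0 < v ∧ ‖u • x + v • y‖ = 1 ∧
      InnerProductGeometry.angle x (u • x + v • y) = t ∧
      InnerProductGeometry.angle (u • x + v • y) y = InnerProductGeometry.angle x y - t := by
  have hin := InnerProductGeometry.cos_angle_mul_norm_mul_norm x y
  set ω := InnerProductGeometry.angle x y with hωdef
  have sω : 0 < Real.sin ω := Real.sin_pos_of_pos_of_lt_pi (by linarith) hω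
  have st : 0 < Real.sin t := Real.sin_pos_of_pos_of_lt_pi ht (by linarith)
  have sωt : 0 < Real.sin (ω - t) := Real.sin_pos_of_pos_of_lt_pi (by linarith) (by linarith)
  have nx : 0 < ‖x‖ := norm_pos_iff.2 hx
  have ny : 0 < ‖y‖ := norm_pos_iff.2 hy
  obtain ⟨u, hu⟩ : ∃ u, u = Real.sin (ω - t) / (Real.sin ω * ‖x‖) := ⟨_, rfl⟩
  obtain ⟨v, hv⟩ : ∃ v, v = Real.sin t / (Real.sin ω * ‖y‖) := ⟨_, rfl⟩
  have u0 : 0 < u := hu ▸ by positivity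
  have v0 : 0 < v := hv ▸ by positivity
  have hu' : Real.sin ω * (u * ‖x‖) = Real.sin (ω - t) := by rw [hu]; field_simp
  have hv' : Real.sin ω * (v * ‖y‖) = Real.sin t := by rw [hv]; field_simp
  have pω := Real.sin_sq_add_cos_sq ω
  have pt := Real.sin_sq_add_cos_sq t
  rw [Real.sin_sub] at hu'
  have hu'' : u * ‖x‖ = Real.cos t - Real.cos ω * (v * ‖y‖) := by
    apply mul_left_cancel₀ sω.ne'
    rw [hu', ← hv']
    ring
  have hnorm : ‖u • x + v • y‖ = 1 := by
    have h1 : ‖u • x + v • y‖ ^ 2 = 1 := by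
      rw [norm_add_sq_real, norm_smul, norm_smul, Real.norm_of_nonneg u0.le,
        Real.norm_of_nonneg v0.le, inner_smul_left, inner_smul_right, ← hin, conj_trivial]
      rw [show u * (v * (Real.cos ω * (‖x‖ * ‖y‖))) = u * ‖x‖ * ((v * ‖y‖) * Real.cos ω) by ring,
        hu'']
      rw [← hv'] at pt
      linear_combination pt - (v * ‖y‖) ^ 2 * pω
    exact (sq_eq_sq₀ (norm_nonneg _) zero_le_one).1 (by rw [h1, one_pow])
  have hne : u • x + v • y ≠ 0 := by rw [← norm_ne_zero_iff, hnorm]; exact one_ne_zero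
  have hang : InnerProductGeometry.angle x (u • x + v • y) = t := by
    rw [InnerProductGeometry.angle, hnorm, mul_one, inner_add_right, inner_smul_right,
      inner_smul_right, ← hin, real_inner_self_eq_norm_sq]
    rw [show (u * ‖x‖ ^ 2 + v * (Real.cos ω * (‖x‖ * ‖y‖))) / ‖x‖ = u * ‖x‖ +
      Real.cos ω * (v * ‖y‖) by field_simp, hu'', sub_add_cancel,
      Real.arccos_cos ht.le (by linarith)]
  refine ⟨u, v, u0, v0, hnorm, hang, ?_⟩
  have := angle_eq_add_of_nonneg_combination u0.le v0.le hne rfl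
  linarith

/-- Laying off a segment of length `l` from the vertex `p` of a triangle into its angle there. -/
theorem exists_ray_point {V : Type*} [NormedAddCommGroup V] [InnerProductSpace ℝ V] {p q r : V}
    {t l : ℝ} (hc : ¬Collinear ℝ {p, q, r}) (hl : 0 < l) (ht : 0 < t)
    (ht' : t < EuclideanGeometry.angle q p r) :
    ∃ O : V, (∃ u v : ℝ, 0 < u ∧ 0 < v ∧ O - p = u • (q - p) + v • (r - p)) ∧ dist O p = l ∧
      EuclideanGeometry.angle q p O = t ∧
      EuclideanGeometry.angle O p r = EuclideanGeometry.angle q p r - t := by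
  have hq : q - p ≠ 0 := sub_ne_zero.2 (ne₁₂_of_not_collinear hc).symm
  have hr : r - p ≠ 0 := sub_ne_zero.2 (ne₁₃_of_not_collinear hc).symm
  have hπ : EuclideanGeometry.angle q p r < Real.pi := by
    refine lt_of_le_of_ne (EuclideanGeometry.angle_le_pi _ _ _) fun h => hc ?_
    rw [Set.insert_comm]
    exact EuclideanGeometry.collinear_of_angle_eq_pi h
  obtain ⟨u, v, hu, hv, hn, h1, h2⟩ := exists_unit_ray hq hr hπ ht ht'
  refine ⟨p + l • (u • (q - p) + v • (r - p)), ⟨l * u, l * v, by positivity, by positivity, ?_⟩,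
    ?_, ?_, ?_⟩
  · module
  · rw [dist_eq_norm, add_sub_cancel_left, norm_smul, hn, mul_one, Real.norm_of_nonneg hl.le]
  · rw [EuclideanGeometry.angle, vsub_eq_sub, vsub_eq_sub, add_sub_cancel_left,
      InnerProductGeometry.angle_smul_right_of_pos _ _ hl, h1]
  · rw [EuclideanGeometry.angle, vsub_eq_sub, vsub_eq_sub, add_sub_cancel_left,
      InnerProductGeometry.angle_smul_left_of_pos _ _ hl, h2]
    rfl

/-- A point in the angle at `p` of a triangle lies inside the triangle, or else it sees the
opposite side `q r` under the sum of the angles under which it sees `p q` and `p r`. -/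
theorem inTriangle_or_angle_eq_add {V : Type*} [NormedAddCommGroup V] [InnerProductSpace ℝ V]
    {p q r O : V} {u v : ℝ} (hc : ¬Collinear ℝ {p, q, r}) (hp : O ≠ p) (hu : 0 < u) (hv : 0 < v)
    (hO : O - p = u • (q - p) + v • (r - p)) :
    InTriangle p q r O ∨ EuclideanGeometry.angle q O r =
      EuclideanGeometry.angle q O p + EuclideanGeometry.angle p O r := by
  have hcomb : u • (q - O) + v • (r - O) = (u + v - 1) • (p - O) := by
    have : u • (q - O) + v • (r - O) = (u • (q - p) + v • (r - p)) - (u + v) • (O - p) := by module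
    rw [this, ← hO]
    module
  rcases lt_trichotomy (u + v) 1 with h | h | h
  · left
    refine ⟨1 - u - v, u, v, by linarith, hu, hv, by ring, ?_⟩
    rw [← sub_add_cancel O p, hO]
    module
  · right
    rw [h, sub_self, zero_smul] at hcomb
    have hrO : r - O ≠ 0 := by
      intro h0
      rw [h0, smul_zero, add_zero, smul_eq_zero_iff_right hu.ne'] at hcomb
      rw [sub_eq_zero] at h0 hcomb
      exact ne₂₃_of_not_collinear hc (hcomb.trans h0.symm)
    have hqO : q - O = (-(v / u)) • (r - O) := by
      have : u • (q - O) = (-v) • (r - O) := by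
        rw [neg_smul, eq_neg_iff_add_eq_zero, hcomb]
      rw [← inv_smul_smul₀ hu.ne' (q - O), this, smul_smul]
      congr 1
      field_simp
    have hπ : EuclideanGeometry.angle q O r = Real.pi := by
      rw [EuclideanGeometry.angle_comm]
      exact InnerProductGeometry.angle_eq_pi_iff.2 ⟨hrO, _, by simpa using div_pos hv hu, hqO⟩
    have := InnerProductGeometry.angle_add_angle_eq_pi_of_angle_eq_pi (p - O) hπ
    rw [hπ, EuclideanGeometry.angle_comm p O r]
    exact this.symm
  · right
    have hpos : 0 < u + v - 1 := by linarith
    refine angle_eq_add_of_nonneg_combination (s := u / (u + v - 1)) (t := v / (u + v - 1))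
      (by positivity) (by positivity) (sub_ne_zero.2 hp.symm) ?_
    simp only [vsub_eq_sub]
    rw [← inv_smul_smul₀ hpos.ne' (p - O), ← hcomb, smul_add, smul_smul, smul_smul, div_eq_inv_mul,
      div_eq_inv_mul]

/-- In a triangle `p q r` there is an inner point that sees `q r` with prescribed base angles
smaller than the angles of the triangle. -/
theorem exists_inTriangle_of_angles {V : Type*} [NormedAddCommGroup V] [InnerProductSpace ℝ V]
    {p q r : V} {α β : ℝ} (hc : ¬Collinear ℝ {p, q, r}) (hα : 0 < α)
    (hα' : α < EuclideanGeometry.angle r q p) (hβ : 0 < β)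
    (hβ' : β < EuclideanGeometry.angle p r q) :
    ∃ O, InTriangle p q r O ∧ EuclideanGeometry.angle O q r = α ∧
      EuclideanGeometry.angle O r q = β ∧ dist O q = dist q r * Real.sin β / Real.sin (α + β) ∧
      dist O r = dist q r * Real.sin α / Real.sin (α + β) := by
  have hc1 := InTriangle.not_collinear_rotate hc
  have hL : 0 < dist q r := dist_pos.2 (ne₂₃_of_not_collinear hc)
  have hsum := EuclideanGeometry.angle_add_angle_add_angle_eq_pi q
    (ne₁₃_of_not_collinear hc).symm
  have h0 := EuclideanGeometry.angle_nonneg q p r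
  rw [EuclideanGeometry.angle_comm q p r] at h0
  rw [EuclideanGeometry.angle_comm r q p] at hα'
  have hlt : α + β < Real.pi := by
    have e1 := EuclideanGeometry.angle_comm p q r
    have e2 := EuclideanGeometry.angle_comm p r q
    have e3 := EuclideanGeometry.angle_comm q p r
    linarith
  have sα : 0 < Real.sin α := Real.sin_pos_of_pos_of_lt_pi hα (by linarith)
  have sβ : 0 < Real.sin β := Real.sin_pos_of_pos_of_lt_pi hβ (by linarith)
  have sαβ : 0 < Real.sin (α + β) := Real.sin_pos_of_pos_of_lt_pi (by linarith) hlt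
  have trig : ∀ x y : ℝ, Real.sin x ^ 2 =
      Real.sin y ^ 2 + Real.sin (x + y) ^ 2 - 2 * Real.sin y * Real.sin (x + y) * Real.cos x := by
    intro x y
    have hx := Real.sin_sq_add_cos_sq x
    have hy := Real.sin_sq_add_cos_sq y
    rw [Real.sin_add]
    linear_combination Real.sin y ^ 2 * hx - Real.sin x ^ 2 * hy
  rw [EuclideanGeometry.angle_comm p q r] at hα'
  obtain ⟨O, ⟨u, v, hu, hv, hO⟩, hdist, hang, -⟩ := exists_ray_point (p := q) (q := r) (r := p)
    (l := dist q r * Real.sin β / Real.sin (α + β)) hc1 (by positivity) hα hα'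
  have hq : EuclideanGeometry.angle O q r = α := by rw [EuclideanGeometry.angle_comm, hang]
  have hOr : dist O r = dist q r * Real.sin α / Real.sin (α + β) := by
    have h1 :=
      EuclideanGeometry.dist_sq_eq_dist_sq_add_dist_sq_sub_two_mul_dist_mul_dist_mul_cos_angle O q r
    rw [hq, hdist, dist_comm r q] at h1
    refine (sq_eq_sq₀ dist_nonneg (by positivity)).1 ?_
    have h2 := trig α β
    rw [mul_div_assoc, mul_pow, div_pow, h2, pow_two (dist O r)]
    rw [h1]
    field_simp
  have hr : EuclideanGeometry.angle O r q = β := by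
    have h1 :=
      EuclideanGeometry.dist_sq_eq_dist_sq_add_dist_sq_sub_two_mul_dist_mul_dist_mul_cos_angle O r q
    have h2 := trig β α
    rw [add_comm β α] at h2
    rw [hOr, hdist] at h1
    refine Real.injOn_cos ⟨EuclideanGeometry.angle_nonneg _ _ _, EuclideanGeometry.angle_le_pi _ _ _⟩
      ⟨hβ.le, by linarith⟩ ?_
    field_simp at h1
    have h3 : 2 * Real.sin α * Real.sin (α + β) * Real.cos (EuclideanGeometry.angle O r q) =
      2 * Real.sin α * Real.sin (α + β) * Real.cos β := by linarith
    exact mul_left_cancel₀ (by positivity) h3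
  refine ⟨O, ?_, hq, hr, hdist, hOr⟩
  -- outside the triangle, the angle at `r` would be too large
  have hw : u + v < 1 := by
    by_contra hw
    push Not at hw
    have hpr : p - r = (1 / v) • (O - r) + ((u + v - 1) / v) • (q - r) := by
      have : v • (p - r) = (O - q) + (q - r) + (u + v - 1) • (q - r) := by
        rw [hO]
        module
      rw [← inv_smul_smul₀ hv.ne' (p - r), this]
      rw [smul_add, smul_smul, ← div_eq_inv_mul, sub_add_sub_cancel, one_div]
    have := angle_eq_add_of_nonneg_combination (by positivity)
      (div_nonneg (by linarith) hv.le) (sub_ne_zero.2 (ne₁₃_of_not_collinear hc)) hpr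
    have h5 : EuclideanGeometry.angle O r q =
      EuclideanGeometry.angle O r p + EuclideanGeometry.angle p r q := this
    have := EuclideanGeometry.angle_nonneg O r p
    linarith
  refine ⟨v, 1 - u - v, u, hv, by linarith, hu, by ring, ?_⟩
  rw [← sub_add_cancel O q, hO]
  module

/-! ### Existence of the decomposition -/

namespace LabeledOctahedron

variable (P : LabeledOctahedron)

theorem faceAngle_sum (ε : Fin 3 → ℤˣ) :
    P.faceAngle ε 0 + P.faceAngle ε 1 + P.faceAngle ε 2 = Real.pi := by
  have hc := P.not_collinear_pt (ε 0) (ε 1) (ε 2)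
  have h := EuclideanGeometry.angle_add_angle_add_angle_eq_pi (P.pt 2 (ε 2))
    (ne₁₂_of_not_collinear hc)
  have h0 : P.faceAngle ε 0 = EuclideanGeometry.angle (P.pt 1 (ε 1)) (P.pt 0 (ε 0))
    (P.pt 2 (ε 2)) := rfl
  have h1 : P.faceAngle ε 1 = EuclideanGeometry.angle (P.pt 2 (ε 2)) (P.pt 1 (ε 1))
    (P.pt 0 (ε 0)) := rfl
  have h2 : P.faceAngle ε 2 = EuclideanGeometry.angle (P.pt 0 (ε 0)) (P.pt 2 (ε 2))
    (P.pt 1 (ε 1)) := rfl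
  rw [h0, h1, h2]
  linarith

theorem two_mul_alpha :
    2 * P.alpha = P.faceAngle T₁ 1 + P.faceAngle T₃ 2 - P.faceAngle T₄ 0 := by
  have := P.faceAngle_sum T₄
  rw [alpha]
  linarith

theorem two_mul_beta :
    2 * P.beta = P.faceAngle T₁ 2 + P.faceAngle T₃ 1 - P.faceAngle T₂ 0 := by
  have := P.faceAngle_sum T₂
  rw [beta]
  linarith

variable {P}

theorem alpha_add_beta {δ : Fin 3 → ℝ} (hδ : ∀ i s, P.coneDeficit i s = δ i)
    (hsum : ∑ i, δ i = 2 * Real.pi) : P.alpha + P.beta = δ 0 / 2 := by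
  rw [Fin.sum_univ_three] at hsum
  have h1 := hδ 1 1
  have h2 := hδ 2 1
  rw [coneDeficit, coneAngle_eq] at h1 h2
  rw [alpha, beta]
  linarith

theorem eq_zero_of_trihedral_combination {u v w : E3} (h : LinearIndependent ℝ ![u, v, w])
    {a b c : ℝ} (habc : a • (u + v) + b • (u - w) + c • (v - w) = 0) :
    a = 0 ∧ b = 0 ∧ c = 0 := by
  have h1 := Fintype.linearIndependent_iff.1 h ![a + b, a + c, -b - c] (by
    rw [Fin.sum_univ_three, ← habc]
    simp only [Matrix.cons_val]
    module)
  have h2 := h1 0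
  have h3 := h1 1
  have h4 := h1 2
  simp only [Matrix.cons_val] at h2 h3 h4
  exact ⟨by linarith, by linarith, by linarith⟩

open InnerProductGeometry in
theorem trihedral_angle_lt {u v w : E3} (h : LinearIndependent ℝ ![u, v, w]) :
    angle (u + v) (u - w) < angle (u + v) (v - w) + angle (u - w) (v - w) ∧
    angle (u + v) (v - w) < angle (u + v) (u - w) + angle (u - w) (v - w) ∧
    angle (u - w) (v - w) < angle (u + v) (u - w) + angle (u + v) (v - w) := by
  refine ⟨?_, ?_, ?_⟩
  · rw [angle_comm (u - w) (v - w)]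
    refine angle_lt_add_of_linearIndependent fun a b c habc => ?_
    have := eq_zero_of_trihedral_combination h (a := a) (b := c) (c := b) (by rw [← habc]; abel)
    tauto
  · exact angle_lt_add_of_linearIndependent fun a b c habc =>
      eq_zero_of_trihedral_combination h habc
  · rw [angle_comm (u + v) (u - w)]
    refine angle_lt_add_of_linearIndependent fun a b c habc => ?_
    have := eq_zero_of_trihedral_combination h (a := b) (b := a) (c := c) (by rw [← habc]; abel)
    tauto

open InnerProductGeometry in
/-- The vectors `v₁ + v₂`, `v₁ - v₃`, `v₂ - v₃` span a trihedron whose angles are an angle of `T₁`,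
one of `T₃` and one of `T₄`. -/
theorem alpha_bounds : 0 < P.alpha ∧ P.alpha < P.faceAngle T₁ 1 ∧ P.alpha < P.faceAngle T₃ 2 := by
  have hli : LinearIndependent ℝ ![P.pt 0 1, P.pt 1 1, P.pt 2 1] := by
    convert P.linearIndependent_pt ![1, 1, 1] using 1
    funext i
    fin_cases i <;> rfl
  have hneg : ∀ i, P.pt i (-1) = -P.pt i 1 := fun i => P.pt_neg i 1
  obtain ⟨h1, h2, h3⟩ := trihedral_angle_lt hli
  have f1 : P.faceAngle T₁ 1 = angle (P.pt 0 1 + P.pt 1 1) (P.pt 1 1 - P.pt 2 1) := by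
    have : P.faceAngle T₁ 1 =
      angle (P.pt 2 (-1) - P.pt 1 (-1)) (P.pt 0 1 - P.pt 1 (-1)) := rfl
    rw [this, hneg, hneg, angle_comm]
    congr 1 <;> abel
  have f3 : P.faceAngle T₃ 2 = angle (P.pt 0 1 - P.pt 2 1) (P.pt 1 1 - P.pt 2 1) := rfl
  have f4 : P.faceAngle T₄ 0 = angle (P.pt 0 1 + P.pt 1 1) (P.pt 0 1 - P.pt 2 1) := by
    have : P.faceAngle T₄ 0 =
      angle (P.pt 1 (-1) - P.pt 0 1) (P.pt 2 1 - P.pt 0 1) := rfl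
    rw [this, hneg, ← angle_neg_neg]
    congr 1 <;> abel
  have := P.two_mul_alpha
  rw [← f1, ← f3, ← f4] at h1 h2 h3
  refine ⟨?_, ?_, ?_⟩ <;> linarith

open InnerProductGeometry in
/-- The same with the roles of `v₂` and `v₃` exchanged, and `T₂` in place of `T₄`. -/
theorem beta_bounds : 0 < P.beta ∧ P.beta < P.faceAngle T₁ 2 ∧ P.beta < P.faceAngle T₃ 1 := by
  have hli : LinearIndependent ℝ ![P.pt 0 1, P.pt 2 1, P.pt 1 1] := by
    have := (P.linearIndependent_pt ![1, 1, 1]).comp ![0, 2, 1] (by decide)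
    convert this using 1
    funext i
    fin_cases i <;> rfl
  have hneg : ∀ i, P.pt i (-1) = -P.pt i 1 := fun i => P.pt_neg i 1
  obtain ⟨h1, h2, h3⟩ := trihedral_angle_lt hli
  have f1 : P.faceAngle T₁ 2 = angle (P.pt 0 1 + P.pt 2 1) (P.pt 2 1 - P.pt 1 1) := by
    have : P.faceAngle T₁ 2 =
      angle (P.pt 0 1 - P.pt 2 (-1)) (P.pt 1 (-1) - P.pt 2 (-1)) := rfl
    rw [this, hneg, hneg]
    congr 1 <;> abel
  have f3 : P.faceAngle T₃ 1 = angle (P.pt 0 1 - P.pt 1 1) (P.pt 2 1 - P.pt 1 1) := by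
    have : P.faceAngle T₃ 1 = angle (P.pt 2 1 - P.pt 1 1) (P.pt 0 1 - P.pt 1 1) := rfl
    rw [this, angle_comm]
  have f4 : P.faceAngle T₂ 0 = angle (P.pt 0 1 + P.pt 2 1) (P.pt 0 1 - P.pt 1 1) := by
    have : P.faceAngle T₂ 0 =
      angle (P.pt 1 1 - P.pt 0 1) (P.pt 2 (-1) - P.pt 0 1) := rfl
    rw [this, hneg, ← angle_neg_neg, angle_comm]
    congr 1 <;> abel
  have := P.two_mul_beta
  rw [← f1, ← f3, ← f4] at h1 h2 h3
  refine ⟨?_, ?_, ?_⟩ <;> linarith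

/-- The points of the decomposition in the four faces at `v₁`. -/
theorem exists_faceSystem {δ : Fin 3 → ℝ} (hδ : ∀ i s, P.coneDeficit i s = δ i)
    (hpos : ∀ i, 0 < δ i) (hsum : ∑ i, δ i = 2 * Real.pi) :
    ∃ O₁ O₂ O₃ O₄ a b c d, P.FaceSystem O₁ O₂ O₃ O₄ a b c d := by
  obtain ⟨α0, α1, α3⟩ := P.alpha_bounds
  obtain ⟨β0, β1, β3⟩ := P.beta_bounds
  have hα := P.two_mul_alpha
  have hβ := P.two_mul_beta
  have hαβ := alpha_add_beta hδ hsum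
  have h0 := hpos 0
  have c1 := P.not_collinear_pt 1 (-1) (-1)
  have c2 := P.not_collinear_pt 1 1 (-1)
  have c3 := P.not_collinear_pt 1 1 1
  have c4 := P.not_collinear_pt 1 (-1) 1
  -- `O₁` and `O₃` come from the prescribed angles
  obtain ⟨O₁, m1, x1, y1, z1, w1⟩ := exists_inTriangle_of_angles c1 α0 α1 β0 β1
  obtain ⟨O₃, m3, x3, y3, z3, w3⟩ := exists_inTriangle_of_angles c3 β0 β3 α0 α3
  rw [dist_pt_neg_one_neg_one] at z1 w1
  rw [add_comm P.beta] at z3 w3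
  have za : dist O₃ (P.pt 1 1) = dist O₁ (P.pt 2 (-1)) := z3.trans w1.symm
  have zb : dist O₃ (P.pt 2 1) = dist O₁ (P.pt 1 (-1)) := w3.trans z1.symm
  have pa : 0 < dist O₁ (P.pt 2 (-1)) := dist_pos.2 (m1.rotate.rotate.ne_left
    (InTriangle.not_collinear_rotate (InTriangle.not_collinear_rotate c1)))
  have pb : 0 < dist O₁ (P.pt 1 (-1)) := dist_pos.2 (m1.rotate.ne_left
    (InTriangle.not_collinear_rotate c1))
  -- `O₂` and `O₄` are the images of both `O₁` and `O₃` under reflections in midpoints of edges;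
  -- each is constructed from its distance and direction at `v₁`
  obtain ⟨O₂, ⟨u2, v2, hu2, hv2, hO2⟩, x2, y2, z2⟩ := exists_ray_point
    (t := P.faceAngle T₃ 1 - P.beta) c2 pa (sub_pos.2 β3)
    (show _ < P.faceAngle T₂ 0 by linarith)
  obtain ⟨O₄, ⟨u4, v4, hu4, hv4, hO4⟩, x4, y4, z4⟩ := exists_ray_point
    (t := P.faceAngle T₁ 1 - P.alpha) c4 pb (sub_pos.2 α1)
    (show _ < P.faceAngle T₄ 0 by linarith)
  have z2' : EuclideanGeometry.angle O₂ (P.pt 0 1) (P.pt 2 (-1)) = P.faceAngle T₂ 0 -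
    (P.faceAngle T₃ 1 - P.beta) := z2
  have z4' : EuclideanGeometry.angle O₄ (P.pt 0 1) (P.pt 2 1) = P.faceAngle T₄ 0 -
    (P.faceAngle T₁ 1 - P.alpha) := z4
  obtain ⟨r1, -, -, -, -, r6, -⟩ := m1.sideAngle_relations c1
    rfl rfl rfl rfl (P.dist_pt_neg_one_neg_one 1 2) rfl
  obtain ⟨t1, -, -, -, -, t6, -⟩ := m3.sideAngle_relations c3 rfl za zb rfl rfl rfl
  have s11 : P.faceAngle T₁ 1 = _ :=
    m1.rotate.angle_left (InTriangle.not_collinear_rotate c1)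
  have s12 : P.faceAngle T₁ 2 = _ := m1.rotate.rotate.angle_left
    (InTriangle.not_collinear_rotate (InTriangle.not_collinear_rotate c1))
  have s31 : P.faceAngle T₃ 1 = _ :=
    m3.rotate.angle_left (InTriangle.not_collinear_rotate c3)
  have s32 : P.faceAngle T₃ 2 = _ := m3.rotate.rotate.angle_left
    (InTriangle.not_collinear_rotate (InTriangle.not_collinear_rotate c3))
  rw [EuclideanGeometry.angle_comm, x1] at s11
  rw [y1] at s12
  rw [EuclideanGeometry.angle_comm, x3] at s31
  rw [y3] at s32
  have d2 : dist O₂ (P.pt 1 1) = dist O₃ (P.pt 0 1) :=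
    (EuclideanGeometry.side_angle_side (a := O₂) (b := P.pt 0 1) (c := P.pt 1 1) (a' := O₃)
      (b' := P.pt 1 1) (c' := P.pt 0 1) (by rw [EuclideanGeometry.angle_comm, y2]; linarith)
      (by rw [x2, za]) (dist_comm _ _)).dist_eq 0 2
  have c2' : dist O₂ (P.pt 2 (-1)) = dist O₁ (P.pt 0 1) :=
    (EuclideanGeometry.side_angle_side (a := O₂) (b := P.pt 0 1) (c := P.pt 2 (-1)) (a' := O₁)
      (b' := P.pt 2 (-1)) (c' := P.pt 0 1)
      (by rw [EuclideanGeometry.angle_comm O₁, z2']; linarith)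
      (by rw [x2]) (dist_comm _ _)).dist_eq 0 2
  have c4' : dist O₄ (P.pt 1 (-1)) = dist O₁ (P.pt 0 1) :=
    (EuclideanGeometry.side_angle_side (a := O₄) (b := P.pt 0 1) (c := P.pt 1 (-1)) (a' := O₁)
      (b' := P.pt 1 (-1)) (c' := P.pt 0 1) (by rw [EuclideanGeometry.angle_comm, y4]; linarith)
      (by rw [x4]) (dist_comm _ _)).dist_eq 0 2
  have d4 : dist O₄ (P.pt 2 1) = dist O₃ (P.pt 0 1) :=
    (EuclideanGeometry.side_angle_side (a := O₄) (b := P.pt 0 1) (c := P.pt 2 1) (a' := O₃)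
      (b' := P.pt 2 1) (c' := P.pt 0 1)
      (by rw [EuclideanGeometry.angle_comm O₃, z4']; linarith)
      (by rw [x4, zb]) (dist_comm _ _)).dist_eq 0 2
  have hO2p : O₂ ≠ P.pt 0 1 := by rw [← dist_pos, x2]; exact pa
  have hO4p : O₄ ≠ P.pt 0 1 := by rw [← dist_pos, x4]; exact pb
  have k2 := inTriangle_or_angle_eq_add c2 hO2p hu2 hv2 hO2
  have k4 := inTriangle_or_angle_eq_add c4 hO4p hu4 hv4 hO4
  have g2 : EuclideanGeometry.angle (P.pt 1 1) O₂ (P.pt 2 (-1)) = sideAngle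
      (dist O₁ (P.pt 0 1)) (dist O₃ (P.pt 0 1)) (dist (P.pt 1 1) (P.pt 2 (-1))) := by
    rw [angle_eq_sideAngle, dist_comm (P.pt 1 1) O₂, dist_comm (P.pt 2 (-1)) O₂, d2, c2',
      sideAngle_comm]
  have g4 : EuclideanGeometry.angle (P.pt 1 (-1)) O₄ (P.pt 2 1) = sideAngle
      (dist O₁ (P.pt 0 1)) (dist O₃ (P.pt 0 1)) (dist (P.pt 1 1) (P.pt 2 (-1))) := by
    rw [angle_eq_sideAngle, dist_comm (P.pt 1 (-1)) O₄, dist_comm (P.pt 2 1) O₄, d4, c4',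
      dist_pt_neg_one_one]
  have p2 : EuclideanGeometry.angle (P.pt 1 1) O₂ (P.pt 0 1) = sideAngle
      (dist O₃ (P.pt 0 1)) (dist O₁ (P.pt 2 (-1))) (dist (P.pt 0 1) (P.pt 1 1)) := by
    rw [angle_eq_sideAngle, dist_comm (P.pt 1 1) O₂, dist_comm (P.pt 0 1) O₂, d2, x2,
      dist_comm (P.pt 1 1)]
  have q2 : EuclideanGeometry.angle (P.pt 0 1) O₂ (P.pt 2 (-1)) = sideAngle
      (dist O₁ (P.pt 0 1)) (dist O₁ (P.pt 2 (-1))) (dist (P.pt 0 1) (P.pt 2 (-1))) := by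
    rw [angle_eq_sideAngle, dist_comm (P.pt 2 (-1)) O₂, dist_comm (P.pt 0 1) O₂, c2', x2,
      sideAngle_comm]
  have p4 : EuclideanGeometry.angle (P.pt 1 (-1)) O₄ (P.pt 0 1) = sideAngle
      (dist O₁ (P.pt 0 1)) (dist O₁ (P.pt 1 (-1))) (dist (P.pt 0 1) (P.pt 1 (-1))) := by
    rw [angle_eq_sideAngle, dist_comm (P.pt 1 (-1)) O₄, dist_comm (P.pt 0 1) O₄, c4', x4,
      dist_comm (P.pt 1 (-1))]
  have q4 : EuclideanGeometry.angle (P.pt 0 1) O₄ (P.pt 2 1) = sideAngle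
      (dist O₃ (P.pt 0 1)) (dist O₁ (P.pt 1 (-1))) (dist (P.pt 0 1) (P.pt 2 1)) := by
    rw [angle_eq_sideAngle, dist_comm (P.pt 2 1) O₄, dist_comm (P.pt 0 1) O₄, d4, x4,
      sideAngle_comm]
  have i2 : InTriangle (P.pt 0 1) (P.pt 1 1) (P.pt 2 (-1)) O₂ → _ := fun h => h.angle_sum c2
  have i4 : InTriangle (P.pt 0 1) (P.pt 1 (-1)) (P.pt 2 1) O₄ → _ := fun h => h.angle_sum c4
  rw [EuclideanGeometry.angle_comm (P.pt 0 1) O₂ (P.pt 1 1), g2, p2, q2] at i2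
  rw [EuclideanGeometry.angle_comm (P.pt 0 1) O₄ (P.pt 1 (-1)), g4, p4, q4] at i4
  rw [g2, p2, q2] at k2
  rw [g4, p4, q4] at k4
  have hle := EuclideanGeometry.angle_le_pi (P.pt 1 1) O₂ (P.pt 2 (-1))
  rw [g2] at hle
  rw [angle_eq_sideAngle, dist_comm (P.pt 2 (-1)), dist_pt_neg_one_neg_one] at x1
  rw [angle_eq_sideAngle, dist_pt_neg_one_neg_one] at y1
  rw [x1, y1] at r6
  rw [sideAngle_comm (dist O₁ (P.pt 2 (-1))) (dist O₁ (P.pt 1 (-1)))] at t1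
  -- the angles that `O₁` and `O₃` contribute add up to `2 * π + δ 0`, with `0 < δ 0`
  have m2 : InTriangle (P.pt 0 1) (P.pt 1 1) (P.pt 2 (-1)) O₂ := by
    rcases k2 with k2 | k2
    · exact k2
    rcases k4 with k4 | k4
    · linarith [i4 k4]
    · linarith
  have m4 : InTriangle (P.pt 0 1) (P.pt 1 (-1)) (P.pt 2 1) O₄ := by
    rcases k4 with k4 | k4
    · exact k4
    · linarith [i2 m2]
  exact ⟨O₁, O₂, O₃, O₄, _, _, _, _, m1, m2, m3, m4, rfl, rfl, rfl, x2, d2, c2', rfl, za, zb, x4,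
    c4', d4⟩

end LabeledOctahedron

/-! ### Octahedra with given coordinates -/

/-- Three vectors `X`, `Y`, `Z` of Euclidean space that span a trihedron: if `x = x₁ + i x₂`,
`y = y₁ + i y₂`, `z = z₁ + i z₂` are complex numbers with positive arguments `ξ`, `η`, `ζ` and
`ξ + η + ζ < π`, then `X`, `Y`, `Z` have lengths `|x|`, `|y|`, `|z|`, and the angles between them are
`ξ + η` (for `X`, `Y`), `ξ + ζ` (for `X`, `Z`) and `η + ζ` (for `Y`, `Z`). The vector `Z` spans the
first axis and `X` lies in the plane of the first two. -/
noncomputable def trihedron (x₁ x₂ y₁ y₂ z₁ z₂ : ℝ) : Fin 3 → E3 :=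
  ![!₂[(x₁ * z₁ - x₂ * z₂) / √(z₁ ^ 2 + z₂ ^ 2), (x₁ * z₂ + x₂ * z₁) / √(z₁ ^ 2 + z₂ ^ 2), 0],
    !₂[(y₁ * z₁ - y₂ * z₂) / √(z₁ ^ 2 + z₂ ^ 2),
      ((x₁ * y₁ - x₂ * y₂) * (z₁ ^ 2 + z₂ ^ 2) - (x₁ * z₁ - x₂ * z₂) * (y₁ * z₁ - y₂ * z₂)) /
        (√(z₁ ^ 2 + z₂ ^ 2) * (x₁ * z₂ + x₂ * z₁)),
      √(4 * (x₂ * y₂ * z₂) * (x₂ * y₁ * z₁ + x₁ * y₂ * z₁ + x₁ * y₁ * z₂ - x₂ * y₂ * z₂)) /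
        (x₁ * z₂ + x₂ * z₁)],
    !₂[√(z₁ ^ 2 + z₂ ^ 2), 0, 0]]

/-- The Gram matrix of `trihedron`. Its determinant `4 Im x Im y Im z Im (x y z)` is, up to the
squared lengths, the classical `4 sin σ sin (σ - A) sin (σ - B) sin (σ - C)` for a trihedron with
angles `A`, `B`, `C` and `σ = (A + B + C) / 2`. -/
theorem trihedron_gram {x₁ x₂ y₁ y₂ z₁ z₂ : ℝ} (hz : 0 < z₂)
    (hM : 0 < x₁ * z₂ + x₂ * z₁)
    (hK : 0 ≤ 4 * (x₂ * y₂ * z₂) *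
      (x₂ * y₁ * z₁ + x₁ * y₂ * z₁ + x₁ * y₁ * z₂ - x₂ * y₂ * z₂)) :
    let T := trihedron x₁ x₂ y₁ y₂ z₁ z₂
    ‖T 0‖ ^ 2 = x₁ ^ 2 + x₂ ^ 2 ∧ ‖T 1‖ ^ 2 = y₁ ^ 2 + y₂ ^ 2 ∧ ‖T 2‖ ^ 2 = z₁ ^ 2 + z₂ ^ 2 ∧
    inner ℝ (T 0) (T 1) = x₁ * y₁ - x₂ * y₂ ∧ inner ℝ (T 0) (T 2) = x₁ * z₁ - x₂ * z₂ ∧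
    inner ℝ (T 1) (T 2) = y₁ * z₁ - y₂ * z₂ := by
  have hzz : 0 < z₁ ^ 2 + z₂ ^ 2 := by positivity
  have hr := Real.sq_sqrt hzz.le
  have hr0 : 0 < √(z₁ ^ 2 + z₂ ^ 2) := Real.sqrt_pos.2 hzz
  have hk := Real.sq_sqrt hK
  intro T
  simp only [EuclideanSpace.norm_sq_eq, PiLp.inner_apply, Fin.sum_univ_three, Real.norm_eq_abs,
    sq_abs, T, trihedron]
  simp only [Matrix.cons_val, RCLike.inner_apply, conj_trivial, mul_zero, add_zero, zero_mul]
  obtain ⟨M, hMd⟩ : ∃ M, M = x₁ * z₂ + x₂ * z₁ := ⟨_, rfl⟩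
  rw [← hMd] at hM
  simp only [← hMd]
  generalize √(z₁ ^ 2 + z₂ ^ 2) = ρ at hr hr0
  generalize √(4 * (x₂ * y₂ * z₂) * (x₂ * y₁ * z₁ + x₁ * y₂ * z₁ + x₁ * y₁ * z₂ -
    x₂ * y₂ * z₂)) = κ at hk
  refine ⟨?_, ?_, ?_, ?_, ?_, ?_⟩
  · rw [div_pow, div_pow, hr]
    field_simp
    rw [hMd]
    ring
  · rw [div_pow, div_pow, div_pow, mul_pow, hr, hk]
    field_simp
    rw [hMd]
    ring
  · rw [hr]
    ring
  · field_simp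
    rw [hr]
    field_simp
    ring
  · field_simp
  · field_simp

/-- The three vectors are linearly independent. -/
theorem trihedron_eq_zero {x₁ x₂ y₁ y₂ z₁ z₂ : ℝ} (hz : 0 < z₂)
    (hM : 0 < x₁ * z₂ + x₂ * z₁)
    (hK : 0 < 4 * (x₂ * y₂ * z₂) *
      (x₂ * y₁ * z₁ + x₁ * y₂ * z₁ + x₁ * y₁ * z₂ - x₂ * y₂ * z₂)) {p q r : ℝ}
    (h : p • trihedron x₁ x₂ y₁ y₂ z₁ z₂ 0 + q • trihedron x₁ x₂ y₁ y₂ z₁ z₂ 1 +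
      r • trihedron x₁ x₂ y₁ y₂ z₁ z₂ 2 = 0) : p = 0 ∧ q = 0 ∧ r = 0 := by
  have hzz : 0 < z₁ ^ 2 + z₂ ^ 2 := by positivity
  have hr0 : 0 < √(z₁ ^ 2 + z₂ ^ 2) := Real.sqrt_pos.2 hzz
  have hk0 := Real.sqrt_pos.2 hK
  have h0 := congrArg (fun v : E3 => v 0) h
  have h1 := congrArg (fun v : E3 => v 1) h
  have h2 := congrArg (fun v : E3 => v 2) h
  simp only [trihedron, PiLp.add_apply, PiLp.smul_apply, Matrix.cons_val, smul_eq_mul, mul_zero,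
    add_zero, zero_add, PiLp.zero_apply, mul_eq_zero, div_eq_zero_iff, hk0.ne', hM.ne',
    or_false] at h0 h1 h2
  subst h2
  simp only [zero_mul, add_zero, mul_eq_zero, div_eq_zero_iff, hr0.ne', hM.ne', or_false] at h1
  subst h1
  simp only [zero_mul, zero_add, mul_eq_zero, hr0.ne', or_false] at h0
  exact ⟨rfl, rfl, h0⟩

theorem continuous_trihedron {α : Type*} [TopologicalSpace α] {x₁ x₂ y₁ y₂ z₁ z₂ : α → ℝ}
    (hx₁ : Continuous x₁) (hx₂ : Continuous x₂) (hy₁ : Continuous y₁) (hy₂ : Continuous y₂)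
    (hz₁ : Continuous z₁) (hz₂ : Continuous z₂) (hz : ∀ t, 0 < z₂ t)
    (hM : ∀ t, 0 < x₁ t * z₂ t + x₂ t * z₁ t) (i : Fin 3) :
    Continuous fun t => trihedron (x₁ t) (x₂ t) (y₁ t) (y₂ t) (z₁ t) (z₂ t) i := by
  have hr : ∀ t, √(z₁ t ^ 2 + z₂ t ^ 2) ≠ 0 := fun t => by
    have := hz t
    positivity
  have hM' : ∀ t, x₁ t * z₂ t + x₂ t * z₁ t ≠ 0 := fun t => (hM t).ne'
  have hrM : ∀ t, √(z₁ t ^ 2 + z₂ t ^ 2) * (x₁ t * z₂ t + x₂ t * z₁ t) ≠ 0 := fun t =>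
    mul_ne_zero (hr t) (hM' t)
  fin_cases i <;> simp only [trihedron] <;> refine (PiLp.continuous_toLp 2 _).comp ?_ <;>
    refine continuous_pi fun j => ?_ <;> fin_cases j <;>
    simp only [Fin.zero_eta, Fin.mk_one, Fin.reduceFinMk, Matrix.cons_val] <;>
    fun_prop (disch := assumption)

namespace LabeledOctahedron


/-- Vertices of an octahedron with coordinates `x` and cone-deficits `δ`. The vectors `v₁ + v₂`,
`v₁ - v₃`, `v₂ - v₃` form a trihedron in which each angle is the sum of two of the three base angles
at the ends of length `b` of the triangles with sides `b, c`, with sides `b, d` and with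
sides `b, a`. -/
noncomputable def vertexOfCoords (δ : Fin 3 → ℝ) (x : Fin 4 → ℝ) : Fin 3 → E3 :=
  let T := trihedron (x 1 + x 2 * Real.cos (δ 2 / 2)) (x 2 * Real.sin (δ 2 / 2))
    (x 1 + x 3 * Real.cos (δ 1 / 2)) (x 3 * Real.sin (δ 1 / 2))
    (x 1 + x 0 * Real.cos (δ 0 / 2)) (x 0 * Real.sin (δ 0 / 2))
  ![(1 / 2 : ℝ) • (T 0 + T 1 - T 2), (1 / 2 : ℝ) • (T 0 - T 1 + T 2),
    (1 / 2 : ℝ) • (T 0 - T 1 - T 2)]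

/-- The addition formulas for the angles of a triangle. -/
theorem sin_cos_relations {A B C : ℝ} (h : A + B + C = Real.pi) :
    Real.cos A = Real.sin B * Real.sin C - Real.cos B * Real.cos C ∧
    Real.sin A = Real.sin B * Real.cos C + Real.cos B * Real.sin C := by
  have hA : A = Real.pi - (B + C) := by linarith
  rw [hA, Real.cos_pi_sub, Real.sin_pi_sub, Real.cos_add, Real.sin_add]
  exact ⟨by ring, rfl⟩

section

variable {a b c d A B C : ℝ}

/-- The sine of the angle between `v₁ + v₂` and `v₂ - v₃`, times their lengths, is positive; it is
twice the area of the face `T₁`. -/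
theorem trihedron_base_pos (ha : 0 < a) (hb : 0 < b) (hc : 0 < c) (hA : 0 < A) (hB : 0 < B)
    (hC : 0 < C) (h : A + B + C = Real.pi) :
    0 < (b + c * Real.cos C) * (a * Real.sin A) + c * Real.sin C * (b + a * Real.cos A) := by
  have sA : 0 < Real.sin A := Real.sin_pos_of_pos_of_lt_pi hA (by linarith)
  have sB : 0 < Real.sin B := Real.sin_pos_of_pos_of_lt_pi hB (by linarith)
  have sC : 0 < Real.sin C := Real.sin_pos_of_pos_of_lt_pi hC (by linarith)
  obtain ⟨-, h2⟩ := sin_cos_relations (A := B) (B := C) (C := A) (by linarith)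
  have : (b + c * Real.cos C) * (a * Real.sin A) + c * Real.sin C * (b + a * Real.cos A) =
      a * b * Real.sin A + b * c * Real.sin C + a * c * Real.sin B := by
    rw [h2]; ring
  rw [this]
  positivity

/-- The Gram determinant of `v₁ + v₂`, `v₁ - v₃`, `v₂ - v₃` is
`4 a b c d sin A sin B sin C` times half the surface area. -/
theorem trihedron_det_pos (ha : 0 < a) (hb : 0 < b) (hc : 0 < c) (hd : 0 < d) (hA : 0 < A)
    (hB : 0 < B) (hC : 0 < C) (h : A + B + C = Real.pi) :
    0 < 4 * (c * Real.sin C * (d * Real.sin B) * (a * Real.sin A)) *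
      (c * Real.sin C * (b + d * Real.cos B) * (b + a * Real.cos A) +
        (b + c * Real.cos C) * (d * Real.sin B) * (b + a * Real.cos A) +
        (b + c * Real.cos C) * (b + d * Real.cos B) * (a * Real.sin A) -
        c * Real.sin C * (d * Real.sin B) * (a * Real.sin A)) := by
  have sA : 0 < Real.sin A := Real.sin_pos_of_pos_of_lt_pi hA (by linarith)
  have sB : 0 < Real.sin B := Real.sin_pos_of_pos_of_lt_pi hB (by linarith)
  have sC : 0 < Real.sin C := Real.sin_pos_of_pos_of_lt_pi hC (by linarith)
  obtain ⟨hcA, hsA⟩ := sin_cos_relations h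
  obtain ⟨-, hsB⟩ := sin_cos_relations (A := B) (B := C) (C := A) (by linarith)
  obtain ⟨-, hsC⟩ := sin_cos_relations (A := C) (B := A) (C := B) (by linarith)
  have key : c * Real.sin C * (b + d * Real.cos B) * (b + a * Real.cos A) +
        (b + c * Real.cos C) * (d * Real.sin B) * (b + a * Real.cos A) +
        (b + c * Real.cos C) * (b + d * Real.cos B) * (a * Real.sin A) -
        c * Real.sin C * (d * Real.sin B) * (a * Real.sin A) =
      b * ((a * b + c * d) * Real.sin A + (a * c + b * d) * Real.sin B +
        (a * d + b * c) * Real.sin C) := by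
    linear_combination (-b * c * d - a * c * d * Real.cos A) * hsA - a * b * c * hsB -
      a * b * d * hsC + a * c * d * Real.sin A * hcA
  rw [key]
  positivity

end

variable {δ : Fin 3 → ℝ}

theorem linearIndependent_vertexOfCoords (hpos : ∀ i, 0 < δ i) (hsum : ∑ i, δ i = 2 * Real.pi)
    {x : Fin 4 → ℝ} (hx : ∀ i, 0 < x i) : LinearIndependent ℝ (vertexOfCoords δ x) := by
  rw [Fin.sum_univ_three] at hsum
  have hs : δ 0 / 2 + δ 1 / 2 + δ 2 / 2 = Real.pi := by linarith
  have h0 := half_pos (hpos 0)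
  have h1 := half_pos (hpos 1)
  have h2 := half_pos (hpos 2)
  rw [Fintype.linearIndependent_iff]
  intro g hg
  rw [Fin.sum_univ_three] at hg
  simp only [vertexOfCoords, Matrix.cons_val] at hg
  obtain ⟨e1, e2, e3⟩ := trihedron_eq_zero
    (mul_pos (hx 0) (Real.sin_pos_of_pos_of_lt_pi h0 (by linarith)))
    (trihedron_base_pos (hx 0) (hx 1) (hx 2) h0 h1 h2 hs)
    (trihedron_det_pos (hx 0) (hx 1) (hx 2) (hx 3) h0 h1 h2 hs)
    (p := (g 0 + g 1 + g 2) / 2) (q := (g 0 - g 1 - g 2) / 2) (r := (-g 0 + g 1 - g 2) / 2)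
    (by rw [← hg]; module)
  intro i
  fin_cases i
  · show g 0 = 0
    linarith
  · show g 1 = 0
    linarith
  · show g 2 = 0
    linarith

/-- The octahedron with coordinates `x` and cone-deficits `δ`. -/
noncomputable def ofCoords (hpos : ∀ i, 0 < δ i) (hsum : ∑ i, δ i = 2 * Real.pi)
    (x : {x : Fin 4 → ℝ // ∀ i, 0 < x i}) : LabeledOctahedron :=
  ⟨vertexOfCoords δ x, linearIndependent_vertexOfCoords hpos hsum x.2⟩

theorem edgeLaw_ofCoords (hpos : ∀ i, 0 < δ i) (hsum : ∑ i, δ i = 2 * Real.pi)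
    (x : {x : Fin 4 → ℝ // ∀ i, 0 < x i}) :
    (ofCoords hpos hsum x).EdgeLaw δ (x.1 0) (x.1 1) (x.1 2) (x.1 3) := by
  have hsum' := hsum
  rw [Fin.sum_univ_three] at hsum'
  have hs : δ 0 / 2 + δ 1 / 2 + δ 2 / 2 = Real.pi := by linarith
  have h0 := half_pos (hpos 0)
  have h1 := half_pos (hpos 1)
  have h2 := half_pos (hpos 2)
  have hx := x.2
  obtain ⟨g1, g2, g3, g4, g5, g6⟩ := trihedron_gram
    (mul_pos (hx 0) (Real.sin_pos_of_pos_of_lt_pi h0 (by linarith)))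
    (trihedron_base_pos (hx 0) (hx 1) (hx 2) h0 h1 h2 hs)
    (trihedron_det_pos (hx 0) (hx 1) (hx 2) (hx 3) h0 h1 h2 hs).le
  have v0 : (ofCoords hpos hsum x).pt 0 1 = vertexOfCoords δ x 0 := pt_one _ 0
  have v1 : (ofCoords hpos hsum x).pt 1 1 = vertexOfCoords δ x 1 := pt_one _ 1
  have v2 : (ofCoords hpos hsum x).pt 2 1 = vertexOfCoords δ x 2 := pt_one _ 2
  have hneg : ∀ i, (ofCoords hpos hsum x).pt i (-1) = -(ofCoords hpos hsum x).pt i 1 :=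
    fun i => pt_neg _ i 1
  obtain ⟨cA, -⟩ := sin_cos_relations hs
  obtain ⟨cB, -⟩ := sin_cos_relations (A := δ 1 / 2) (B := δ 2 / 2) (C := δ 0 / 2) (by linarith)
  obtain ⟨cC, -⟩ := sin_cos_relations (A := δ 2 / 2) (B := δ 0 / 2) (C := δ 1 / 2) (by linarith)
  have pA := Real.sin_sq_add_cos_sq (δ 0 / 2)
  have pB := Real.sin_sq_add_cos_sq (δ 1 / 2)
  have pC := Real.sin_sq_add_cos_sq (δ 2 / 2)
  generalize hT : trihedron (x.1 1 + x.1 2 * Real.cos (δ 2 / 2)) (x.1 2 * Real.sin (δ 2 / 2))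
    (x.1 1 + x.1 3 * Real.cos (δ 1 / 2)) (x.1 3 * Real.sin (δ 1 / 2))
    (x.1 1 + x.1 0 * Real.cos (δ 0 / 2)) (x.1 0 * Real.sin (δ 0 / 2)) = T at g1 g2 g3 g4 g5 g6
  simp only [vertexOfCoords, hT, Matrix.cons_val] at v0 v1 v2
  refine ⟨?_, ?_, ?_, ?_, ?_, ?_⟩ <;> simp only [dist_eq_norm, hneg, v0, v1, v2]
  · rw [show (1 / 2 : ℝ) • (T 0 + T 1 - T 2) - (1 / 2 : ℝ) • (T 0 - T 1 + T 2) = T 1 - T 2 by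
      module, norm_sub_sq_real, g2, g3, g6]
    linear_combination x.1 3 ^ 2 * pB + x.1 0 ^ 2 * pA - 2 * x.1 0 * x.1 3 * cC
  · rw [show (1 / 2 : ℝ) • (T 0 + T 1 - T 2) - -((1 / 2 : ℝ) • (T 0 - T 1 + T 2)) = T 0 by
      module, g1]
    linear_combination x.1 2 ^ 2 * pC
  · rw [show (1 / 2 : ℝ) • (T 0 + T 1 - T 2) - (1 / 2 : ℝ) • (T 0 - T 1 - T 2) = T 1 by
      module, g2]
    linear_combination x.1 3 ^ 2 * pB
  · rw [show (1 / 2 : ℝ) • (T 0 + T 1 - T 2) - -((1 / 2 : ℝ) • (T 0 - T 1 - T 2)) = T 0 - T 2 by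
      module, norm_sub_sq_real, g1, g3, g5]
    linear_combination x.1 2 ^ 2 * pC + x.1 0 ^ 2 * pA - 2 * x.1 0 * x.1 2 * cB
  · rw [show (1 / 2 : ℝ) • (T 0 - T 1 + T 2) - (1 / 2 : ℝ) • (T 0 - T 1 - T 2) = T 2 by
      module, g3]
    linear_combination x.1 0 ^ 2 * pA
  · rw [show (1 / 2 : ℝ) • (T 0 - T 1 + T 2) - -((1 / 2 : ℝ) • (T 0 - T 1 - T 2)) = T 0 - T 1 by
      module, norm_sub_sq_real, g1, g2, g4]
    linear_combination x.1 2 ^ 2 * pC + x.1 3 ^ 2 * pB - 2 * x.1 2 * x.1 3 * cA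

theorem continuous_vertexOfCoords (hpos : ∀ i, 0 < δ i) (hsum : ∑ i, δ i = 2 * Real.pi) :
    Continuous fun x : {x : Fin 4 → ℝ // ∀ i, 0 < x i} => vertexOfCoords δ x := by
  rw [Fin.sum_univ_three] at hsum
  have hs : δ 0 / 2 + δ 1 / 2 + δ 2 / 2 = Real.pi := by linarith
  have h0 := half_pos (hpos 0)
  have h1 := half_pos (hpos 1)
  have h2 := half_pos (hpos 2)
  have hx : ∀ i, Continuous fun x : {x : Fin 4 → ℝ // ∀ i, 0 < x i} => x.1 i := fun i =>
    (continuous_apply i).comp continuous_subtype_val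
  have hx0 := hx 0
  have hx1 := hx 1
  have hx2 := hx 2
  have hx3 := hx 3
  have hT := continuous_trihedron
    (x₁ := fun x : {x : Fin 4 → ℝ // ∀ i, 0 < x i} => x.1 1 + x.1 2 * Real.cos (δ 2 / 2))
    (x₂ := fun x => x.1 2 * Real.sin (δ 2 / 2))
    (y₁ := fun x => x.1 1 + x.1 3 * Real.cos (δ 1 / 2))
    (y₂ := fun x => x.1 3 * Real.sin (δ 1 / 2))
    (z₁ := fun x => x.1 1 + x.1 0 * Real.cos (δ 0 / 2))
    (z₂ := fun x => x.1 0 * Real.sin (δ 0 / 2)) (hx1.add (hx2.mul_const _)) (hx2.mul_const _)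
    (hx1.add (hx3.mul_const _)) (hx3.mul_const _) (hx1.add (hx0.mul_const _)) (hx0.mul_const _)
    (fun x => mul_pos (x.2 0) (Real.sin_pos_of_pos_of_lt_pi h0 (by linarith)))
    (fun x => trihedron_base_pos (x.2 0) (x.2 1) (x.2 2) h0 h1 h2 hs)
  have hT0 := hT 0
  have hT1 := hT 1
  have hT2 := hT 2
  refine continuous_pi fun i => ?_
  fin_cases i <;> simp only [vertexOfCoords, Fin.zero_eta, Fin.mk_one, Fin.reduceFinMk,
    Matrix.cons_val] <;> fun_prop

end LabeledOctahedron

/-! ### Isometries, continuity and the homeomorphism -/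

namespace LabeledOctahedron

variable {P Q : LabeledOctahedron} {δ : Fin 3 → ℝ}

theorem pt_ne_pt (P : LabeledOctahedron) {i j : Fin 3} (hij : i ≠ j) (s t : ℤˣ) :
    P.pt i s ≠ P.pt j t := by
  have := (P.linearIndependent_pt fun k => if k = i then s else t).injective.ne hij
  simpa [hij.symm] using this

/-- Octahedra with the same edge lengths are related by a linear isometry. -/
theorem labelIsometric_of_dist_eq
    (h : ∀ i j s t, i ≠ j → dist (P.pt i s) (P.pt j t) = dist (Q.pt i s) (Q.pt j t)) :
    P.LabelIsometric Q := by
  -- the parallelogram law recovers the Gram matrix from the edge lengths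
  have hadd : ∀ i j, i ≠ j → ‖P.vertex i + P.vertex j‖ = ‖Q.vertex i + Q.vertex j‖ := by
    intro i j hij
    have := h i j 1 (-1) hij
    simpa [pt_neg, pt_one, dist_eq_norm] using this
  have hsub : ∀ i j, i ≠ j → ‖P.vertex i - P.vertex j‖ = ‖Q.vertex i - Q.vertex j‖ := by
    intro i j hij
    have := h i j 1 1 hij
    simpa [pt_one, dist_eq_norm] using this
  have hnorm2 : ∀ i j, i ≠ j → ‖P.vertex i‖ ^ 2 + ‖P.vertex j‖ ^ 2 =
      ‖Q.vertex i‖ ^ 2 + ‖Q.vertex j‖ ^ 2 := by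
    intro i j hij
    have h1 := norm_add_sq_real (P.vertex i) (P.vertex j)
    have h2 := norm_sub_sq_real (P.vertex i) (P.vertex j)
    have h3 := norm_add_sq_real (Q.vertex i) (Q.vertex j)
    have h4 := norm_sub_sq_real (Q.vertex i) (Q.vertex j)
    rw [hadd i j hij] at h1
    rw [hsub i j hij] at h2
    linarith
  have hinner : ∀ i j, inner ℝ (P.vertex i) (P.vertex j) =
      (inner ℝ (Q.vertex i) (Q.vertex j) : ℝ) := by
    intro i j
    by_cases hij : i = j
    · subst hij
      rw [real_inner_self_eq_norm_sq, real_inner_self_eq_norm_sq]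
      have h1 := hnorm2 i (i + 1) ((show ∀ i : Fin 3, i ≠ i + 1 from by decide) i)
      have h2 := hnorm2 i (i + 2) ((show ∀ i : Fin 3, i ≠ i + 2 from by decide) i)
      have h3 := hnorm2 (i + 1) (i + 2) ((show ∀ i : Fin 3, i + 1 ≠ i + 2 from by decide) i)
      linarith
    · have h1 := norm_add_sq_real (P.vertex i) (P.vertex j)
      have h3 := norm_add_sq_real (Q.vertex i) (Q.vertex j)
      rw [hadd i j hij] at h1
      have := hnorm2 i j hij
      linarith
  have hcard : Fintype.card (Fin 3) = Module.finrank ℝ E3 := by simp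
  let bP := basisOfLinearIndependentOfCardEqFinrank P.linearIndependent hcard
  let bQ := basisOfLinearIndependentOfCardEqFinrank Q.linearIndependent hcard
  have hbP : ∀ i, bP i = P.vertex i := fun i => by simp [bP]
  have hbQ : ∀ i, bQ i = Q.vertex i := fun i => by simp [bQ]
  have hb : ∀ i, bP.equiv bQ (Equiv.refl _) (P.vertex i) = Q.vertex i := by
    intro i
    rw [← hbP, ← hbQ]
    exact Module.Basis.equiv_apply bP i bQ (Equiv.refl _)
  let e : E3 ≃ₗᵢ[ℝ] E3 := (bP.equiv bQ (Equiv.refl _)).isometryOfInner (by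
    intro x y
    rw [← bP.sum_repr x, ← bP.sum_repr y]
    simp only [map_sum, map_smul, sum_inner, inner_sum, inner_smul_left, inner_smul_right, hbP, hb,
      hinner])
  have he : ∀ i s, e (P.pt i s) = Q.pt i s := by
    intro i s
    have h1 : e (P.vertex i) = Q.vertex i := hb i
    rcases Int.units_eq_one_or s with rfl | rfl
    · rw [pt_one, pt_one, h1]
    · rw [pt_neg, pt_neg, map_neg, pt_one, pt_one, h1]
  have hbody : e '' P.body = Q.body := by
    have h1 := (e.toLinearEquiv : E3 →ₗ[ℝ] E3).image_convexHull
      (Set.range fun p : Fin 3 × ℤˣ => P.pt p.1 p.2)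
    have h2 : (e '' P.body) = convexHull ℝ (e '' Set.range fun p : Fin 3 × ℤˣ => P.pt p.1 p.2) := h1
    rw [h2, ← Set.range_comp]
    simp only [Function.comp_def, he]
    rfl
  refine ⟨⟨e.toEquiv.subtypeEquiv fun x => ?_, fun x y => ?_⟩, fun i s => ?_⟩
  · constructor
    · intro hx
      rw [← hbody]
      exact ⟨x, hx, rfl⟩
    · intro hx
      rw [← hbody] at hx
      obtain ⟨y, hy, hxy⟩ := hx
      rwa [← e.injective hxy]
  · exact e.isometry x.1 y.1
  · exact Subtype.ext (he i s)

theorem LabelIsometric.dist_eq (h : P.LabelIsometric Q) (i j : Fin 3) (s t : ℤˣ) :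
    dist (P.pt i s) (P.pt j t) = dist (Q.pt i s) (Q.pt j t) := by
  obtain ⟨f, hf⟩ := h
  have := f.dist_eq (P.bodyPt i s) (P.bodyPt j t)
  rw [hf, hf] at this
  exact this.symm

theorem LabelIsometric.coordFormula_eq (h : P.LabelIsometric Q) :
    P.coordFormula δ = Q.coordFormula δ := by
  simp only [coordFormula, alpha, beta, faceAngle, angle_eq_sideAngle, h.dist_eq]

theorem EdgeLaw.labelIsometric {a b c d : ℝ} (hP : P.EdgeLaw δ a b c d)
    (hQ : Q.EdgeLaw δ a b c d) : P.LabelIsometric Q := by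
  have sq : ∀ {x y z : ℝ}, 0 ≤ x → 0 ≤ y → x ^ 2 = z → y ^ 2 = z → x = y := fun hx hy h1 h2 =>
    (sq_eq_sq₀ hx hy).1 (h1.trans h2.symm)
  have key : ∀ i j, i < j → ∀ t, dist (P.pt i 1) (P.pt j t) = dist (Q.pt i 1) (Q.pt j t) := by
    intro i j hij t
    rcases Int.units_eq_one_or t with rfl | rfl
    · fin_cases i <;> fin_cases j <;> first | exact absurd hij (by decide) | skip
      · exact sq dist_nonneg dist_nonneg hP.e12 hQ.e12
      · exact sq dist_nonneg dist_nonneg hP.e13 hQ.e13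
      · exact sq dist_nonneg dist_nonneg hP.e23 hQ.e23
    · fin_cases i <;> fin_cases j <;> first | exact absurd hij (by decide) | skip
      · exact sq dist_nonneg dist_nonneg hP.e12' hQ.e12'
      · exact sq dist_nonneg dist_nonneg hP.e13' hQ.e13'
      · exact sq dist_nonneg dist_nonneg hP.e23' hQ.e23'
  have key2 : ∀ i j, i < j → ∀ s t, dist (P.pt i s) (P.pt j t) = dist (Q.pt i s) (Q.pt j t) := by
    intro i j hij s t
    rcases Int.units_eq_one_or s with rfl | rfl
    · exact key i j hij t
    · rw [← dist_pt_neg P, ← dist_pt_neg Q, neg_neg]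
      exact key i j hij (-t)
  refine labelIsometric_of_dist_eq fun i j s t hij => ?_
  rcases lt_or_gt_of_ne hij with h | h
  · exact key2 i j h s t
  · rw [dist_comm, dist_comm (Q.pt i s)]
    exact key2 j i h t s

theorem continuous_pt (i : Fin 3) (s : ℤˣ) :
    Continuous fun P : OctahedraWithDeficits δ => P.1.pt i s := by
  have h : Continuous fun P : OctahedraWithDeficits δ => P.1.vertex i :=
    (continuous_apply i).comp continuous_induced_dom
  rcases Int.units_eq_one_or s with rfl | rfl
  · simpa only [pt_one] using h
  · simp only [pt_neg, pt_one]
    exact h.neg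

theorem continuous_faceAngle (ε : Fin 3 → ℤˣ) (i : Fin 3) :
    Continuous fun P : OctahedraWithDeficits δ => P.1.faceAngle ε i := by
  rw [continuous_iff_continuousAt]
  intro P
  have h1 : P.1.pt (i + 1) (ε (i + 1)) ≠ P.1.pt i (ε i) :=
    pt_ne_pt _ ((show ∀ i : Fin 3, i + 1 ≠ i from by decide) i) _ _
  have h2 : P.1.pt (i + 2) (ε (i + 2)) ≠ P.1.pt i (ε i) :=
    pt_ne_pt _ ((show ∀ i : Fin 3, i + 2 ≠ i from by decide) i) _ _
  exact (EuclideanGeometry.continuousAt_angle (x := (P.1.pt (i + 1) (ε (i + 1)), P.1.pt i (ε i),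
    P.1.pt (i + 2) (ε (i + 2)))) h1 h2).comp (f := fun P : OctahedraWithDeficits δ =>
      (P.1.pt (i + 1) (ε (i + 1)), P.1.pt i (ε i), P.1.pt (i + 2) (ε (i + 2))))
    ((continuous_pt _ _).prodMk ((continuous_pt _ _).prodMk (continuous_pt _ _))).continuousAt

theorem continuous_coordFormula :
    Continuous fun P : OctahedraWithDeficits δ => P.1.coordFormula δ := by
  have hd : ∀ i j s t, Continuous fun P : OctahedraWithDeficits δ =>
    dist (P.1.pt i s) (P.1.pt j t) := fun i j s t => (continuous_pt i s).dist (continuous_pt j t)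
  have hα : Continuous fun P : OctahedraWithDeficits δ => P.1.alpha :=
    (((((continuous_faceAngle _ _).add (continuous_faceAngle _ _)).add
      (continuous_faceAngle _ _)).add (continuous_faceAngle _ _)).sub continuous_const).div_const _
  have hβ : Continuous fun P : OctahedraWithDeficits δ => P.1.beta :=
    (((((continuous_faceAngle _ _).add (continuous_faceAngle _ _)).add
      (continuous_faceAngle _ _)).add (continuous_faceAngle _ _)).sub continuous_const).div_const _
  have ha := ((hd 1 2 1 1).mul (Real.continuous_sin.comp hα)).div_const (Real.sin (δ 0 / 2))
  have hb := ((hd 1 2 1 1).mul (Real.continuous_sin.comp hβ)).div_const (Real.sin (δ 0 / 2))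
  refine continuous_pi fun i => ?_
  fin_cases i
  · exact ha
  · exact hb
  · exact Real.continuous_sqrt.comp (((hb.pow 2).add ((hd 0 1 1 (-1)).pow 2)).sub
      (((continuous_const.mul hb).mul (hd 0 1 1 (-1))).mul
        (Real.continuous_cos.comp ((continuous_faceAngle _ _).sub hα))))
  · exact Real.continuous_sqrt.comp (((ha.pow 2).add ((hd 0 1 1 1).pow 2)).sub
      (((continuous_const.mul ha).mul (hd 0 1 1 1)).mul
        (Real.continuous_cos.comp ((continuous_faceAngle _ _).sub hβ))))

theorem IsParallelogramDecomposition.coords_eq {O : (Fin 3 → ℤˣ) → E3}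
    (h : P.IsParallelogramDecomposition O) (hδ : ∀ i s, P.coneDeficit i s = δ i)
    (h0 : 0 < δ 0) (h0' : δ 0 < 2 * Real.pi) : P.coords O = P.coordFormula δ :=
  (h.faceSystem.coordFormula_eq hδ h0 h0').symm

theorem IsParallelogramDecomposition.unique {O O' : (Fin 3 → ℤˣ) → E3}
    (h : P.IsParallelogramDecomposition O) (h' : P.IsParallelogramDecomposition O')
    (hδ : ∀ i s, P.coneDeficit i s = δ i) (h0 : 0 < δ 0) (h0' : δ 0 < 2 * Real.pi) : O = O' := by
  have hc := (h.coords_eq hδ h0 h0').trans (h'.coords_eq hδ h0 h0').symm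
  have f := h.faceSystem
  have f' := h'.faceSystem
  have ha : dist (O T₁) (P.pt 2 (-1)) = dist (O' T₁) (P.pt 2 (-1)) := congrFun hc 0
  have hb : dist (O T₁) (P.pt 1 (-1)) = dist (O' T₁) (P.pt 1 (-1)) := congrFun hc 1
  have hcc : dist (O T₁) (P.pt 0 1) = dist (O' T₁) (P.pt 0 1) := congrFun hc 2
  have hd : dist (O T₃) (P.pt 0 1) = dist (O' T₃) (P.pt 0 1) := congrFun hc 3
  funext ε
  revert ε
  refine forall_of_neg (fun ε hε => ?_) ?_ ?_ ?_ ?_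
  · rw [h.antipodal, h'.antipodal, hε]
  · exact f.mem₁.eq_of_dist_eq f'.mem₁ hcc hb ha
  · exact f.mem₂.eq_of_dist_eq f'.mem₂ (f.dist₂₀.trans (ha.trans f'.dist₂₀.symm))
      (f.dist₂₁.trans (hd.trans f'.dist₂₁.symm)) (f.dist₂₂.trans (hcc.trans f'.dist₂₂.symm))
  · exact f.mem₃.eq_of_dist_eq f'.mem₃ hd (f.dist₃₁.trans (ha.trans f'.dist₃₁.symm))
      (f.dist₃₂.trans (hb.trans f'.dist₃₂.symm))
  · exact f.mem₄.eq_of_dist_eq f'.mem₄ (f.dist₄₀.trans (hb.trans f'.dist₄₀.symm))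
      (f.dist₄₁.trans (hcc.trans f'.dist₄₁.symm)) (f.dist₄₂.trans (hd.trans f'.dist₄₂.symm))

/-- The coordinate map is a homeomorphism from octahedra up to isometry onto the positive
orthant, with inverse induced by `ofCoords`. -/
theorem exists_homeomorph (hpos : ∀ i, 0 < δ i) (hsum : ∑ i, δ i = 2 * Real.pi) :
    ∃ Φ : OctahedronSpace δ ≃ₜ {x : Fin 4 → ℝ // ∀ i, 0 < x i},
      ∀ P : OctahedraWithDeficits δ,
        (Φ (Quotient.mk (octahedraSetoid δ) P) : Fin 4 → ℝ) = P.1.coordFormula δ := by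
  have h0 := hpos 0
  have h0' : δ 0 < 2 * Real.pi := by
    have h1 := hpos 1
    have h2 := hpos 2
    rw [Fin.sum_univ_three] at hsum
    linarith
  have hsys : ∀ P : OctahedraWithDeficits δ, ∃ O₁ O₂ O₃ O₄ a b c d,
      P.1.FaceSystem O₁ O₂ O₃ O₄ a b c d := fun P => exists_faceSystem P.2 hpos hsum
  have hcoord : ∀ P : OctahedraWithDeficits δ, (∀ i, 0 < P.1.coordFormula δ i) ∧
      P.1.EdgeLaw δ (P.1.coordFormula δ 0) (P.1.coordFormula δ 1) (P.1.coordFormula δ 2)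
        (P.1.coordFormula δ 3) := by
    intro P
    obtain ⟨O₁, O₂, O₃, O₄, a, b, c, d, hF⟩ := hsys P
    rw [hF.coordFormula_eq P.2 h0 h0']
    refine ⟨fun i => ?_, hF.edgeLaw P.2⟩
    obtain ⟨ha, hb, hc, hd⟩ := hF.pos
    fin_cases i <;> assumption
  have hdef : ∀ x i s, (ofCoords hpos hsum x).coneDeficit i s = δ i := fun x i s =>
    (edgeLaw_ofCoords hpos hsum x).coneDeficit_eq hpos hsum (x.2 0) (x.2 1) (x.2 2) (x.2 3) i s
  have hinv : ∀ x, (ofCoords hpos hsum x).coordFormula δ = x.1 := by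
    intro x
    obtain ⟨O₁, O₂, O₃, O₄, hF⟩ := (edgeLaw_ofCoords hpos hsum x).exists_faceSystem hpos hsum
      (x.2 0) (x.2 1) (x.2 2) (x.2 3)
    rw [hF.coordFormula_eq (hdef x) h0 h0']
    funext i
    fin_cases i <;> rfl
  let F : OctahedraWithDeficits δ → {x : Fin 4 → ℝ // ∀ i, 0 < x i} := fun P =>
    ⟨P.1.coordFormula δ, (hcoord P).1⟩
  have hFcont : Continuous F := continuous_coordFormula.subtype_mk _
  have hFresp : ∀ P Q : OctahedraWithDeficits δ, P ≈ Q → F P = F Q := fun P Q h =>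
    Subtype.ext (LabelIsometric.coordFormula_eq h)
  let G : {x : Fin 4 → ℝ // ∀ i, 0 < x i} → OctahedraWithDeficits δ := fun x =>
    ⟨ofCoords hpos hsum x, hdef x⟩
  have hGcont : Continuous G :=
    continuous_induced_rng.2 (continuous_vertexOfCoords hpos hsum)
  refine ⟨⟨⟨Quotient.lift F hFresp, fun x => Quotient.mk _ (G x), ?_, ?_⟩,
    hFcont.quotient_lift hFresp, continuous_quotient_mk'.comp hGcont⟩, fun P => rfl⟩
  · intro q
    induction q using Quotient.ind with
    | _ P =>
      refine Quotient.sound ?_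
      exact (edgeLaw_ofCoords hpos hsum (F P)).labelIsometric (hcoord P).2
  · intro x
    exact Subtype.ext (hinv x)

end LabeledOctahedron

theorem corollary1 (δ : Fin 3 → ℝ) (hpos : ∀ i, 0 < δ i) (hsum : ∑ i, δ i = 2 * Real.pi) :
    (∀ P : OctahedraWithDeficits δ,
      ∃! O : (Fin 3 → ℤˣ) → E3, P.1.IsParallelogramDecomposition O) ∧
    (∀ (P : OctahedraWithDeficits δ) (O : (Fin 3 → ℤˣ) → E3) (a b c d : ℝ),
      P.1.IsParallelogramDecomposition O → P.1.coords O = ![a, b, c, d] →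
      P.1.surfaceArea =
        2 * ((a * b + c * d) * Real.sin (δ 0 / 2) + (a * c + b * d) * Real.sin (δ 1 / 2) +
          (a * d + b * c) * Real.sin (δ 2 / 2))) ∧
    (∃ Φ : OctahedronSpace δ ≃ₜ {x : Fin 4 → ℝ // ∀ i, 0 < x i},
      ∀ (P : OctahedraWithDeficits δ) (O : (Fin 3 → ℤˣ) → E3),
        P.1.IsParallelogramDecomposition O →
        (Φ (Quotient.mk (octahedraSetoid δ) P) : Fin 4 → ℝ) = P.1.coords O) := by
  have h0 := hpos 0
  have h0' : δ 0 < 2 * Real.pi := by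
    have h1 := hpos 1
    have h2 := hpos 2
    rw [Fin.sum_univ_three] at hsum
    linarith
  refine ⟨fun P => ?_, fun P O a b c d hO hcoords => ?_, ?_⟩
  · obtain ⟨O₁, O₂, O₃, O₄, a, b, c, d, hF⟩ :=
      LabeledOctahedron.exists_faceSystem P.2 hpos hsum
    exact ⟨_, hF.isParallelogramDecomposition, fun O hO =>
      hO.unique hF.isParallelogramDecomposition P.2 h0 h0'⟩
  · have hF := hO.faceSystem
    obtain ⟨ha, hb, hc, hd⟩ := hF.pos
    have h := (hF.edgeLaw P.2).surfaceArea_eq hpos hsum ha hb hc hd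
    have ea : dist (O LabeledOctahedron.T₁) (P.1.pt 2 (-1)) = a := congrFun hcoords 0
    have eb : dist (O LabeledOctahedron.T₁) (P.1.pt 1 (-1)) = b := congrFun hcoords 1
    have ec : dist (O LabeledOctahedron.T₁) (P.1.pt 0 1) = c := congrFun hcoords 2
    have ed : dist (O LabeledOctahedron.T₃) (P.1.pt 0 1) = d := congrFun hcoords 3
    rwa [ea, eb, ec, ed] at h
  · obtain ⟨Φ, hΦ⟩ := LabeledOctahedron.exists_homeomorph hpos hsum
    exact ⟨Φ, fun P O hO => (hΦ P).trans (hO.coords_eq P.2 h0 h0').symm⟩
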